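/- Two finite strings $X,Y$ of numbers, of the same length $m$, are *order-equivalent*, $X\approx Y$, if $X[i]<X[j]\Leftrightarrow Y[i]<Y[j]$ for all $1\le i,j\le m$. Let $S$ be a string of $n$ integers. A number $1\le p<n$ is an *initial op-period* of $S$ if $S$ is a prefix of a concatenation $V_1V_2\cdots V_k$ of strings with $|V_1|=\dots=|V_k|=p$ and $V_1\approx\dots\approx V_k$. (The letters of the $V_i$ may be arbitrary rational numbers, so that the last, possibly incomplete, block of $S$ only has to be order-equivalent to a prefix of the first block.) **Theorem.** The smallest initial op-period $p>1$ of a string $S$ of length $n$ over an integer alphabet that is polynomially bounded in $n$ can be computed in $O(n)$ time on a word RAM with words of $O(\log n)$ bits. Precisely: there is one program such that for every $c\in\mathbb N$ there is a constant $C$ with the following property. For every string $S$ of $n$ integers of absolute value at most $(n+2)^c$, the program run on input $S$, on a machine whose words are the integers of absolute value at most $(n+2)^C$, halts without overflow after at most $C(n+1)$ elementary steps (arithmetic operations, comparisons, memory accesses, jumps). Its output is the smallest initial op-period of $S$ that is greater than $1$, or $0$ if there is none. -/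

import Mathlib

/-! ### Order-preserving periods -/

namespace OP

/-- Two strings are order-equivalent: they have the same length and their letters at any two
positions compare in the same way. -/
def OrderEquiv (X Y : List ℚ) : Prop :=
  X.length = Y.length ∧
    ∀ (i j : ℕ) (hi : i < X.length) (hj : j < X.length) (hi' : i < Y.length) (hj' : j < Y.length),
      X[i] < X[j] ↔ Y[i] < Y[j]

/-- `p` is an op-period of the integer string `S` with shift `s ∈ {0, …, p - 1}`: we have `p < |S|`,
and `S` occurs in a concatenation `V₁ V₂ ⋯ Vₖ` of pairwise order-equivalent strings of length `p`
in such a way that its first `s` letters end `V₁` and the rest of it is a prefix of `V₂ ⋯ Vₖ`.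
The blocks `Vᵢ` may use arbitrary rational letters, so that the incomplete first and last blocks of
`S` matter only through their order shapes. -/
def HasOpPeriod (S : List ℤ) (p s : ℕ) : Prop :=
  s < p ∧ p < S.length ∧
    ∃ (V₁ : List ℚ) (Vs : List (List ℚ)),
      (∀ V ∈ V₁ :: Vs, V.length = p) ∧
      (∀ V ∈ V₁ :: Vs, ∀ W ∈ V₁ :: Vs, OrderEquiv V W) ∧
      (S.map (fun x : ℤ => (x : ℚ))).take s <:+ V₁ ∧
      (S.map (fun x : ℤ => (x : ℚ))).drop s <+: Vs.flatten

/-- An op-period is initial if `0` is one of its shifts. -/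
def IsInitialOpPeriod (S : List ℤ) (p : ℕ) : Prop := HasOpPeriod S p 0

/-! ### The machine model

A word RAM with structured control flow. A machine word is an integer of absolute value at most `B`;
an operation whose result is not a word aborts the computation. The machine has registers, and finitely
many (those that the program names) arrays of words that are addressed by words. Each arithmetic
operation, comparison, memory access and jump takes one unit of time. -/

/-- Operations on words. Comparisons return `1` for true and `0` for false; `div` is the integer
quotient (the value of a division by zero is `0`). -/
inductive BinOp where
  | add | sub | mul | div | lt | eq

def BinOp.apply : BinOp → ℤ → ℤ → ℤ
  | .add, x, y => x + y
  | .sub, x, y => x - y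
  | .mul, x, y => x * y
  | .div, x, y => x / y
  | .lt, x, y => if x < y then 1 else 0
  | .eq, x, y => if x = y then 1 else 0

/-- Expressions: constants, registers, array cells `a[e]`, and operations. -/
inductive Expr where
  | const (k : ℤ)
  | reg (x : ℕ)
  | read (a : ℕ) (e : Expr)
  | bin (o : BinOp) (e f : Expr)

/-- Programs. The expression in `ite` and `loop` (a while loop) is the test; nonzero means true. -/
inductive Cmd where
  | skip
  | assign (x : ℕ) (e : Expr)
  | write (a : ℕ) (e f : Expr)
  | seq (c d : Cmd)
  | ite (e : Expr) (c d : Cmd)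
  | loop (e : Expr) (c : Cmd)

/-- Memory contents: `reg x` is register `x`, and `arr a i` is the cell `a[i]`. -/
structure State where
  reg : ℕ → ℤ
  arr : ℕ → ℤ → ℤ

def State.setReg (σ : State) (x : ℕ) (v : ℤ) : State :=
  { σ with reg := Function.update σ.reg x v }

def State.setArr (σ : State) (a : ℕ) (i v : ℤ) : State :=
  { σ with arr := Function.update σ.arr a (Function.update (σ.arr a) i v) }

/-- `v`, provided that it is a machine word. -/
def word (B : ℕ) (v : ℤ) : Option ℤ := if |v| ≤ (B : ℤ) then some v else none

/-- The value of an expression; `none` if an overflow occurs. -/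
def Expr.eval (B : ℕ) (σ : State) : Expr → Option ℤ
  | .const k => word B k
  | .reg x => some (σ.reg x)
  | .read a e => (e.eval B σ).map (σ.arr a)
  | .bin o e f => (e.eval B σ).bind fun x => (f.eval B σ).bind fun y => word B (o.apply x y)

/-- The time for evaluating an expression. -/
def Expr.cost : Expr → ℕ
  | .const _ => 1
  | .reg _ => 1
  | .read _ e => e.cost + 1
  | .bin _ e f => e.cost + f.cost + 1

/-- `Exec B c σ t τ`: with words of absolute value at most `B`, the program `c` started in state `σ`
halts after exactly `t` units of time, in state `τ`, and no overflow occurs. -/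
inductive Exec (B : ℕ) : Cmd → State → ℕ → State → Prop where
  | skip (σ : State) : Exec B .skip σ 1 σ
  | assign (σ : State) (x : ℕ) (e : Expr) (v : ℤ) (he : e.eval B σ = some v) :
      Exec B (.assign x e) σ (e.cost + 1) (σ.setReg x v)
  | write (σ : State) (a : ℕ) (e f : Expr) (i v : ℤ)
      (he : e.eval B σ = some i) (hf : f.eval B σ = some v) :
      Exec B (.write a e f) σ (e.cost + f.cost + 1) (σ.setArr a i v)
  | seq (σ τ ρ : State) (c d : Cmd) (t u : ℕ) (hc : Exec B c σ t τ) (hd : Exec B d τ u ρ) :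
      Exec B (.seq c d) σ (t + u) ρ
  | ite_true (σ τ : State) (e : Expr) (c d : Cmd) (v : ℤ) (t : ℕ)
      (he : e.eval B σ = some v) (hv : v ≠ 0) (hc : Exec B c σ t τ) :
      Exec B (.ite e c d) σ (e.cost + 1 + t) τ
  | ite_false (σ τ : State) (e : Expr) (c d : Cmd) (t : ℕ)
      (he : e.eval B σ = some 0) (hd : Exec B d σ t τ) :
      Exec B (.ite e c d) σ (e.cost + 1 + t) τ
  | loop_true (σ τ ρ : State) (e : Expr) (c : Cmd) (v : ℤ) (t u : ℕ)
      (he : e.eval B σ = some v) (hv : v ≠ 0) (hc : Exec B c σ t τ)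
      (hl : Exec B (.loop e c) τ u ρ) :
      Exec B (.loop e c) σ (e.cost + 1 + t + u) ρ
  | loop_false (σ : State) (e : Expr) (c : Cmd) (he : e.eval B σ = some 0) :
      Exec B (.loop e c) σ (e.cost + 1) σ

/-- The initial state on input `S`: register `0` holds the length of `S`, cell `i` of array `0`
holds the letter of `S` at the (zero-based) position `i`, and everything else is `0`. -/
def inputState (S : List ℤ) : State where
  reg x := if x = 0 then (S.length : ℤ) else 0
  arr a i := if a = 0 ∧ 0 ≤ i then S.getD i.toNat 0 else 0

end OP

/-!
Let `S = f 0, f 1, …, f (n - 1)`. By `isInitialOpPeriod_iff`, a positive `p < n` is an initial op-period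
of `S` if and only if `Per f p n` holds: each block of length `p` (the last one possibly incomplete) has
the order shape of the first one.

*Order shapes.* As the letters are polynomially bounded in `n`, a constant number of rounds of radix
sort in base `n + 2` lists the positions in the order of their letters (`within_sortPositions`). Deleting
the positions `n - 1, n - 2, …` from the doubly linked version of this list gives, for each position
`i`, its neighbours in this order among the positions before `i` (`within_link`, `within_unlink`). A
match of order shapes can be extended by a letter if and only if this letter compares to the two
neighbours as it should (`Match.succ_iff`), so the Z-algorithm computes in linear time, for each
position `i`, the length of the longest substring at `i` that is order-equivalent to a prefix of `S`
(`within_prefixArray`).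

*Short periods.* A break is a position whose step from its predecessor is of another kind (ascent,
descent, plateau) than the step from `0` to `1`; let `l` be the least one, and `h` the greatest common
divisor of all of them. For `p ≤ l` the first block has no break inside, hence `p` is an initial op-period
if and only if all breaks are multiples of `p`, that is, `p ∣ h` (`GcdInv.per_iff`). If `h ≠ 1`, then the
least divisor of `h` greater than `1` is the answer.

*Long periods.* If `h = 1`, then the candidates `p > l` are tested in increasing order, block by block.
Assume that `p` fails at the position `m`, a multiple of `p`. A candidate `q` with `p < q ≤ m - p`
cannot be an initial op-period: a variant of the theorem of Fine and Wilf applies to `p` and `q` on the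
prefix of length `p + q ≤ m`. If `d = gcd p q > 1`, then `d` is an initial op-period of this prefix, hence
of the block of length `q` and of `S`, but `d ≤ p` has been excluded; if `d = 1`, then all
steps inside the block of length `p` are of the same kind, which contradicts the break at `l < p`
(`not_per_of_per_prefix`). So the search may continue with `max (p + 1) (m - p + 1)`, and the number of
block tests telescopes to `O(n)` (`within_search`).
-/

namespace OP

/-! ### Reasoning about programs -/

instance : Add Expr := ⟨.bin .add⟩
instance : Sub Expr := ⟨.bin .sub⟩
instance : Mul Expr := ⟨.bin .mul⟩
instance : Div Expr := ⟨.bin .div⟩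

/-- The remainder `e % f`, computed from the quotient, as the machine has only `div`. -/
instance : Mod Expr := ⟨fun e f => e - e / f * f⟩

/-- The test `e < f`. -/
def Expr.lt (e f : Expr) : Expr := .bin .lt e f

/-- The test `e = f`. -/
def Expr.eq (e f : Expr) : Expr := .bin .eq e f

/-- The value of an expression over unbounded integers. -/
def Expr.val (σ : State) : Expr → ℤ
  | .const k => k
  | .reg x => σ.reg x
  | .read a e => σ.arr a (e.val σ)
  | .bin o e f => o.apply (e.val σ) (f.val σ)

/-- No overflow occurs in the evaluation of an expression. -/
def Expr.Ok (B : ℕ) (σ : State) : Expr → Prop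
  | .const k => |k| ≤ (B : ℤ)
  | .reg _ => True
  | .read _ e => e.Ok B σ
  | .bin o e f => e.Ok B σ ∧ f.Ok B σ ∧ |o.apply (e.val σ) (f.val σ)| ≤ (B : ℤ)

theorem Expr.Ok.eval {B : ℕ} {σ : State} : ∀ {e : Expr}, e.Ok B σ → e.eval B σ = some (e.val σ)
  | .const k, h => by simpa [Expr.eval, Expr.val, word, Expr.Ok] using h
  | .reg x, _ => rfl
  | .read a e, h => by
    have := Expr.Ok.eval (e := e) h
    simp [Expr.eval, Expr.val, this]
  | .bin o e f, h => by
    have h1 := Expr.Ok.eval h.1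
    have h2 := Expr.Ok.eval h.2.1
    have h3 := h.2.2
    simp [Expr.eval, Expr.val, h1, h2, word, h3]

section
variable (B : ℕ) (σ : State) (e f : Expr) (k : ℤ) (x : ℕ)

@[simp] theorem Expr.val_const : (Expr.const k).val σ = k := rfl
@[simp] theorem Expr.val_reg : (Expr.reg x).val σ = σ.reg x := rfl
@[simp] theorem Expr.val_read : (Expr.read x e).val σ = σ.arr x (e.val σ) := rfl
@[simp] theorem Expr.val_add : (e + f).val σ = e.val σ + f.val σ := rfl
@[simp] theorem Expr.val_sub : (e - f).val σ = e.val σ - f.val σ := rfl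
@[simp] theorem Expr.val_mul : (e * f).val σ = e.val σ * f.val σ := rfl
@[simp] theorem Expr.val_div : (e / f).val σ = e.val σ / f.val σ := rfl
@[simp] theorem Expr.val_lt : (e.lt f).val σ = if e.val σ < f.val σ then 1 else 0 := rfl
@[simp] theorem Expr.val_eq : (e.eq f).val σ = if e.val σ = f.val σ then 1 else 0 := rfl
@[simp] theorem Expr.val_mod : (e % f).val σ = e.val σ % f.val σ := by
  change e.val σ - e.val σ / f.val σ * f.val σ = _
  rw [Int.emod_def, mul_comm]

@[simp] theorem Expr.ok_const : (Expr.const k).Ok B σ ↔ |k| ≤ (B : ℤ) := Iff.rfl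
@[simp] theorem Expr.ok_reg : (Expr.reg x).Ok B σ := trivial
@[simp] theorem Expr.ok_read : (Expr.read x e).Ok B σ ↔ e.Ok B σ := Iff.rfl
@[simp] theorem Expr.ok_add : (e + f).Ok B σ ↔
    e.Ok B σ ∧ f.Ok B σ ∧ |e.val σ + f.val σ| ≤ (B : ℤ) := Iff.rfl
@[simp] theorem Expr.ok_sub : (e - f).Ok B σ ↔
    e.Ok B σ ∧ f.Ok B σ ∧ |e.val σ - f.val σ| ≤ (B : ℤ) := Iff.rfl
@[simp] theorem Expr.ok_mul : (e * f).Ok B σ ↔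
    e.Ok B σ ∧ f.Ok B σ ∧ |e.val σ * f.val σ| ≤ (B : ℤ) := Iff.rfl
@[simp] theorem Expr.ok_div : (e / f).Ok B σ ↔
    e.Ok B σ ∧ f.Ok B σ ∧ |e.val σ / f.val σ| ≤ (B : ℤ) := Iff.rfl
end

theorem Expr.ok_mod {B : ℕ} {σ : State} {e f : Expr} (he : e.Ok B σ) (hf : f.Ok B σ)
    (h0 : 0 ≤ e.val σ) (hB : e.val σ ≤ B) (h1 : 0 ≤ f.val σ) : (e % f).Ok B σ := by
  have hq : 0 ≤ e.val σ / f.val σ := Int.ediv_nonneg h0 h1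
  have hq' : e.val σ / f.val σ ≤ e.val σ := Int.ediv_le_self _ h0
  have hm : 0 ≤ e.val σ / f.val σ * f.val σ := mul_nonneg hq h1
  have hm' : e.val σ / f.val σ * f.val σ ≤ e.val σ := by
    rcases h1.eq_or_lt with h | h
    · simpa [← h] using h0
    · exact Int.ediv_mul_le _ h.ne'
  change e.Ok B σ ∧ ((e.Ok B σ ∧ f.Ok B σ ∧ |e.val σ / f.val σ| ≤ (B : ℤ)) ∧ f.Ok B σ ∧
    |e.val σ / f.val σ * f.val σ| ≤ (B : ℤ)) ∧
    |e.val σ - e.val σ / f.val σ * f.val σ| ≤ (B : ℤ)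
  refine ⟨he, ⟨⟨he, hf, ?_⟩, hf, ?_⟩, ?_⟩ <;> exact abs_le.2 ⟨by linarith, by linarith⟩

theorem abs_ite_le {B : ℕ} (hB : 1 ≤ B) (p : Prop) [Decidable p] :
    |if p then (1 : ℤ) else 0| ≤ (B : ℤ) := by
  split_ifs <;> simp
  omega

@[simp] theorem Expr.ok_lt {B : ℕ} {σ : State} {e f : Expr} (hB : 1 ≤ B) :
    (e.lt f).Ok B σ ↔ e.Ok B σ ∧ f.Ok B σ :=
  ⟨fun h => ⟨h.1, h.2.1⟩, fun h => ⟨h.1, h.2, abs_ite_le hB _⟩⟩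

@[simp] theorem Expr.ok_eq {B : ℕ} {σ : State} {e f : Expr} (hB : 1 ≤ B) :
    (e.eq f).Ok B σ ↔ e.Ok B σ ∧ f.Ok B σ :=
  ⟨fun h => ⟨h.1, h.2.1⟩, fun h => ⟨h.1, h.2, abs_ite_le hB _⟩⟩

@[simp] theorem State.reg_setReg (σ : State) (x y : ℕ) (v : ℤ) :
    (σ.setReg x v).reg y = if y = x then v else σ.reg y := by
  simp [State.setReg, Function.update_apply]

@[simp] theorem State.arr_setReg (σ : State) (x : ℕ) (v : ℤ) : (σ.setReg x v).arr = σ.arr := rfl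

@[simp] theorem State.reg_setArr (σ : State) (a : ℕ) (i v : ℤ) :
    (σ.setArr a i v).reg = σ.reg := rfl

@[simp] theorem State.arr_setArr (σ : State) (a b : ℕ) (i v : ℤ) :
    (σ.setArr a i v).arr b = if b = a then Function.update (σ.arr b) i v else σ.arr b := by
  by_cases h : b = a
  · subst h; simp [State.setArr]
  · simp [State.setArr, h]

/-- Weakest precondition of a loop-free program with respect to `Q`. -/
def Cmd.wp (B : ℕ) : Cmd → State → (State → Prop) → Prop
  | .skip, σ, Q => Q σ
  | .assign x e, σ, Q => e.Ok B σ ∧ Q (σ.setReg x (e.val σ))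
  | .write a e f, σ, Q => e.Ok B σ ∧ f.Ok B σ ∧ Q (σ.setArr a (e.val σ) (f.val σ))
  | .seq c d, σ, Q => c.wp B σ fun τ => d.wp B τ Q
  | .ite e c d, σ, Q => e.Ok B σ ∧ (e.val σ ≠ 0 → c.wp B σ Q) ∧ (e.val σ = 0 → d.wp B σ Q)
  | .loop _ _, _, _ => False

/-- A bound for the running time of a loop-free program (meaningless for loops). -/
def Cmd.cost : Cmd → ℕ
  | .skip => 1
  | .assign _ e => e.cost + 1
  | .write _ e f => e.cost + f.cost + 1
  | .seq c d => c.cost + d.cost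
  | .ite e c d => e.cost + 1 + (c.cost + d.cost)
  | .loop _ _ => 0

/-- The registers that a program may change. -/
def Cmd.regs : Cmd → List ℕ
  | .skip => []
  | .assign x _ => [x]
  | .write _ _ _ => []
  | .seq c d => c.regs ++ d.regs
  | .ite _ c d => c.regs ++ d.regs
  | .loop _ c => c.regs

/-- The arrays that a program may change. -/
def Cmd.arrs : Cmd → List ℕ
  | .skip => []
  | .assign _ _ => []
  | .write a _ _ => [a]
  | .seq c d => c.arrs ++ d.arrs
  | .ite _ c d => c.arrs ++ d.arrs
  | .loop _ c => c.arrs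

/-- `σ` and `τ` agree on everything that `c` cannot change. -/
def Frame (c : Cmd) (σ τ : State) : Prop :=
  (∀ x, x ∉ c.regs → τ.reg x = σ.reg x) ∧ ∀ a, a ∉ c.arrs → τ.arr a = σ.arr a

theorem Frame.refl (c : Cmd) (σ : State) : Frame c σ σ := ⟨fun _ _ => rfl, fun _ _ => rfl⟩

theorem Frame.trans {c : Cmd} {σ τ ρ : State} (h : Frame c σ τ) (h' : Frame c τ ρ) :
    Frame c σ ρ :=
  ⟨fun x hx => (h'.1 x hx).trans (h.1 x hx), fun a ha => (h'.2 a ha).trans (h.2 a ha)⟩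

/-- A program changes only the registers and arrays to which it assigns. -/
theorem Exec.frame {B : ℕ} {c : Cmd} {σ τ : State} {t : ℕ} (h : Exec B c σ t τ) :
    Frame c σ τ := by
  induction h with
  | skip => exact Frame.refl _ _
  | assign σ x e v he => exact ⟨fun y hy => by simp_all [Cmd.regs], fun _ _ => rfl⟩
  | write σ a e f i v he hf => exact ⟨fun _ _ => rfl, fun b hb => by simp_all [Cmd.arrs]⟩
  | seq σ τ ρ c d t u hc hd ihc ihd =>
    refine ⟨fun x hx => ?_, fun a ha => ?_⟩
    · simp only [Cmd.regs, List.mem_append, not_or] at hx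
      rw [ihd.1 x hx.2, ihc.1 x hx.1]
    · simp only [Cmd.arrs, List.mem_append, not_or] at ha
      rw [ihd.2 a ha.2, ihc.2 a ha.1]
  | ite_true σ τ e c d v t he hv hc ih =>
    refine ⟨fun x hx => ih.1 x ?_, fun a ha => ih.2 a ?_⟩ <;> simp_all [Cmd.regs, Cmd.arrs]
  | ite_false σ τ e c d t he hd ih =>
    refine ⟨fun x hx => ih.1 x ?_, fun a ha => ih.2 a ?_⟩ <;> simp_all [Cmd.regs, Cmd.arrs]
  | loop_true σ τ ρ e c v t u he hv hc hl ihc ihl => exact Frame.trans (c := c) ihc ihl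
  | loop_false => exact Frame.refl _ _

/-- Total correctness with a time bound: `c`, started in `σ`, halts without overflow after at most
`T` units of time, in a state that satisfies `Q`. -/
def Within (B : ℕ) (c : Cmd) (σ : State) (T : ℕ) (Q : State → Prop) : Prop :=
  ∃ t τ, Exec B c σ t τ ∧ t ≤ T ∧ Q τ

theorem Within.mono {B : ℕ} {c : Cmd} {σ : State} {T T' : ℕ} {Q Q' : State → Prop}
    (h : Within B c σ T Q) (hT : T ≤ T') (hQ : ∀ τ, Q τ → Frame c σ τ → Q' τ) :
    Within B c σ T' Q' := by
  obtain ⟨t, τ, he, ht, hq⟩ := h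
  exact ⟨t, τ, he, ht.trans hT, hQ τ hq he.frame⟩

theorem Within.seq {B : ℕ} {c d : Cmd} {σ : State} {T T' : ℕ} {R Q : State → Prop}
    (h : Within B c σ T R) (h' : ∀ τ, R τ → Frame c σ τ → Within B d τ T' Q) :
    Within B (.seq c d) σ (T + T') Q := by
  obtain ⟨t, τ, he, ht, hq⟩ := h
  obtain ⟨u, ρ, he', hu, hq'⟩ := h' τ hq he.frame
  exact ⟨t + u, ρ, .seq _ _ _ _ _ _ _ he he', by omega, hq'⟩

theorem Within.ite {B : ℕ} {e : Expr} {c d : Cmd} {σ : State} {T : ℕ} {Q : State → Prop}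
    (he : e.Ok B σ) (hc : e.val σ ≠ 0 → Within B c σ T Q)
    (hd : e.val σ = 0 → Within B d σ T Q) :
    Within B (.ite e c d) σ (e.cost + 1 + T) Q := by
  by_cases h : e.val σ = 0
  · obtain ⟨t, τ, hx, ht, hq⟩ := hd h
    exact ⟨_, τ, .ite_false _ _ _ _ _ _ (by rw [he.eval, h]) hx, by omega, hq⟩
  · obtain ⟨t, τ, hx, ht, hq⟩ := hc h
    exact ⟨_, τ, .ite_true _ _ _ _ _ _ _ he.eval h hx, by omega, hq⟩

/-- A loop-free program satisfies its weakest precondition. -/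
theorem Within.of_wp {B : ℕ} : ∀ {c : Cmd} {σ : State} {Q : State → Prop},
    c.wp B σ Q → Within B c σ c.cost Q
  | .skip, σ, _, h => ⟨1, σ, .skip σ, le_rfl, h⟩
  | .assign _ _, _, _, h => ⟨_, _, .assign _ _ _ _ h.1.eval, le_rfl, h.2⟩
  | .write _ _ _, _, _, h => ⟨_, _, .write _ _ _ _ _ _ h.1.eval h.2.1.eval, le_rfl, h.2.2⟩
  | .seq c d, _, _, h =>
    Within.seq (Within.of_wp (c := c) h) fun _ hτ _ => Within.of_wp (c := d) hτ
  | .ite _ _ _, _, _, h =>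
    Within.ite h.1
      (fun hv => (Within.of_wp (h.2.1 hv)).mono (Nat.le_add_right _ _) fun _ hq _ => hq)
      (fun hv => (Within.of_wp (h.2.2 hv)).mono (Nat.le_add_left _ _) fun _ hq _ => hq)
  | .loop _ _, _, _, h => h.elim

/-- The rule for loops: `I` is an invariant, and `φ` bounds the number of remaining iterations,
each of which takes at most `T` units of time. -/
theorem Within.loop {B : ℕ} {e : Expr} {c : Cmd} {σ₀ : State} {T : ℕ} (I : State → Prop)
    (φ : State → ℕ) (h0 : I σ₀)
    (h : ∀ σ, I σ → Frame c σ₀ σ → e.Ok B σ ∧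
      (e.val σ ≠ 0 → Within B c σ T fun τ => I τ ∧ φ τ < φ σ)) :
    Within B (.loop e c) σ₀ ((φ σ₀ + 1) * (e.cost + 1 + T)) fun τ => I τ ∧ e.val τ = 0 := by
  suffices H : ∀ (m : ℕ) (σ : State), φ σ ≤ m → I σ → Frame c σ₀ σ →
      Within B (.loop e c) σ ((m + 1) * (e.cost + 1 + T)) fun τ => I τ ∧ e.val τ = 0 from
    H _ σ₀ le_rfl h0 (Frame.refl _ _)
  intro m
  induction m with
  | zero =>
    intro σ hm hI hF
    obtain ⟨hok, hb⟩ := h σ hI hF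
    by_cases hv : e.val σ = 0
    · exact ⟨_, σ, .loop_false _ _ _ (by rw [hok.eval, hv]), by omega, hI, hv⟩
    · obtain ⟨t, τ, -, -, -, hlt⟩ := hb hv
      omega
  | succ m ih =>
    intro σ hm hI hF
    obtain ⟨hok, hb⟩ := h σ hI hF
    by_cases hv : e.val σ = 0
    · exact ⟨_, σ, .loop_false _ _ _ (by rw [hok.eval, hv]), by
        rw [Nat.succ_mul]; omega, hI, hv⟩
    · obtain ⟨t, τ, hx, ht, hIτ, hlt⟩ := hb hv
      obtain ⟨u, ρ, hx', hu, hq⟩ := ih τ (by omega) hIτ (hF.trans hx.frame)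
      refine ⟨_, ρ, .loop_true _ _ _ _ _ _ _ _ hok.eval hv hx hx', ?_, hq⟩
      rw [Nat.succ_mul]
      omega

/-- The rule for a loop with a loop-free body after a loop-free initialization: `I` is an invariant,
`φ ≤ N` bounds the number of remaining iterations, and `K` the time that each of them takes. -/
theorem Within.seq_loop {B : ℕ} {e : Expr} {c₀ c : Cmd} {σ : State} (K : ℕ) (I : State → Prop)
    (φ : State → ℕ) (N : ℕ) (hK₀ : c₀.cost ≤ K) (hK : e.cost + 1 + c.cost ≤ K)
    (h0 : c₀.wp B σ fun τ => I τ ∧ φ τ ≤ N)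
    (h : ∀ τ, I τ → Frame (.seq c₀ (.loop e c)) σ τ → e.Ok B τ ∧
      (e.val τ ≠ 0 → c.wp B τ fun ρ => I ρ ∧ φ ρ < φ τ)) :
    Within B (.seq c₀ (.loop e c)) σ (K * (N + 2)) fun τ => I τ ∧ e.val τ = 0 := by
  have hT : c₀.cost + (N + 1) * K ≤ K * (N + 2) := by
    calc c₀.cost + (N + 1) * K ≤ K + (N + 1) * K := by omega
      _ = K * (N + 2) := by ring
  refine (Within.seq (Within.of_wp h0) fun τ hτ hF => ?_).mono hT fun _ hq _ => hq
  refine (Within.loop (T := c.cost) I φ hτ.1 fun ρ hρ hF' => ?_).mono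
    (Nat.mul_le_mul (Nat.succ_le_succ hτ.2) hK) fun _ hq _ => hq
  obtain ⟨h1, h2⟩ := h ρ hρ (Frame.trans (τ := τ)
    ⟨fun x hx => hF.1 x fun hx' => hx (by simp [Cmd.regs, hx']),
      fun a ha => hF.2 a fun ha' => ha (by simp [Cmd.arrs, ha'])⟩
    ⟨fun x hx => hF'.1 x fun hx' => hx (by simp [Cmd.regs, hx']),
      fun a ha => hF'.2 a fun ha' => ha (by simp [Cmd.arrs, ha'])⟩)
  exact ⟨h1, fun hv => Within.of_wp (h2 hv)⟩

/-! ### Combinatorics of initial op-periods -/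

/-- The prefix of length `m` of `f 0, f 1, …` splits into blocks of length `p` (the last one possibly
incomplete) that have the order shape of the first block. -/
def Per (f : ℤ → ℤ) (p m : ℤ) : Prop :=
  ∀ i j, 0 ≤ i → i < m → 0 ≤ j → j < m → i / p = j / p → (f i < f j ↔ f (i % p) < f (j % p))

/-- `f a` compares to `f b` as `f c` does to `f d`. -/
def SameCmp (f : ℤ → ℤ) (a b c d : ℤ) : Prop :=
  (f a < f b ↔ f c < f d) ∧ (f b < f a ↔ f d < f c)

/-- The step from position `b - 1` to position `b` is of another kind (ascent, descent, plateau)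
than the step from `0` to `1`. -/
def IsBreak (f : ℤ → ℤ) (b : ℤ) : Prop := ¬ SameCmp f 0 1 (b - 1) b

theorem Per.mono {f : ℤ → ℤ} {p m m' : ℤ} (h : Per f p m) (hm : m' ≤ m) : Per f p m' :=
  fun i j hi him hj hjm hij => h i j hi (by omega) hj (by omega) hij

/-- A period `d` of a block of length `q` is inherited from the block by the whole string. -/
theorem Per.of_dvd {f : ℤ → ℤ} {d q n : ℤ} (hd : 0 < d) (hq : 0 < q) (hdq : d ∣ q)
    (h : Per f q n) (h' : Per f d q) : Per f d n := by
  obtain ⟨e, rfl⟩ := hdq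
  have key : ∀ i : ℤ, i % (d * e) / d = i / d - e * (i / (d * e)) := fun i => by
    rw [Int.emod_def, mul_assoc, Int.sub_mul_ediv_left _ _ hd.ne']
  intro i j hi him hj hjm hij
  have hij' : i / (d * e) = j / (d * e) := by
    rw [← Int.ediv_ediv_of_nonneg hd.le, ← Int.ediv_ediv_of_nonneg hd.le, hij]
  rw [h i j hi him hj hjm hij', h' _ _ (Int.emod_nonneg _ hq.ne') (Int.emod_lt_of_pos _ hq)
    (Int.emod_nonneg _ hq.ne') (Int.emod_lt_of_pos _ hq) (by rw [key, key, hij, hij']),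
    Int.emod_emod_of_dvd _ (Dvd.intro _ rfl), Int.emod_emod_of_dvd _ (Dvd.intro _ rfl)]

/-- The multiples of `q` run through all residues modulo a coprime `p`. -/
theorem exists_mul_emod_eq {p q : ℤ} (hp : 0 < p) (h : IsCoprime p q) {r : ℤ} (hr : 0 ≤ r)
    (hrp : r < p) : ∃ t : ℕ, (t : ℤ) < p ∧ (t : ℤ) * q % p = r := by
  obtain ⟨a, b, hab⟩ := h
  have h0 := Int.emod_nonneg (b * r) hp.ne'
  refine ⟨(b * r % p).toNat, ?_, ?_⟩
  · have := Int.emod_lt_of_pos (b * r) hp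
    omega
  · rw [Int.toNat_of_nonneg h0, Int.mul_emod, Int.emod_emod_of_dvd _ dvd_rfl, ← Int.mul_emod]
    have : b * r * q = r + p * (- (a * r)) := by linear_combination r * hab
    rw [this, Int.add_mul_emod_self_left, Int.emod_eq_of_lt hr hrp]

/-- The theorem of Fine and Wilf for coprime periods. -/
theorem eq_zero_of_coprime_periods {α : Type*} {g : ℤ → α} {p q : ℤ} (hp : 0 < p) (hpq : p < q)
    (hc : IsCoprime p q) (h1 : ∀ i, 0 ≤ i → i < p + q → g i = g (i % p))
    (h2 : ∀ i, 0 ≤ i → i < p + q → g i = g (i % q)) {i : ℤ} (hi : 0 ≤ i) (hi' : i < p + q) :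
    g i = g 0 := by
  have step : ∀ t : ℕ, g ((t : ℤ) * q % p) = g 0 := by
    intro t
    induction t with
    | zero => simp
    | succ t ih =>
      have h0 := Int.emod_nonneg ((t : ℤ) * q) hp.ne'
      have h0' := Int.emod_lt_of_pos ((t : ℤ) * q) hp
      rw [← ih]
      have e1 := h1 ((t : ℤ) * q % p + q) (by omega) (by omega)
      have e2 := h2 ((t : ℤ) * q % p + q) (by omega) (by omega)
      rw [Int.emod_add_emod] at e1
      rw [Int.add_emod_right, Int.emod_eq_of_lt h0 (by omega)] at e2
      rw [← e2, e1]
      congr 2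
      push_cast
      ring
  obtain ⟨t, -, ht⟩ := exists_mul_emod_eq hp hc (Int.emod_nonneg i hp.ne')
    (Int.emod_lt_of_pos i hp)
  rw [h1 i hi hi', ← ht, step]

/-- A variant of the theorem of Fine and Wilf: nothing is known at the multiples of `p`
with respect to the period `p`, nor at the multiples of `q` with respect to the period `q`. -/
theorem eq_one_of_coprime_periods {α : Type*} {g : ℤ → α} {p q : ℤ} (hp : 1 < p) (hpq : p < q)
    (hc : IsCoprime p q) (h1 : ∀ i, 0 < i → i < p + q → ¬ p ∣ i → g i = g (i % p))
    (h2 : ∀ i, 0 < i → i < p + q → ¬ q ∣ i → g i = g (i % q)) {i : ℤ} (hi : 0 < i) (hi' : i < p) :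
    g i = g 1 := by
  -- The residues `q, 2q, …, (p - 1) q` modulo `p` are exactly those other than `0`.
  have hnd : ∀ t : ℕ, 0 < t → (t : ℤ) < p → ¬ p ∣ (t : ℤ) * q := fun t h0 ht hdvd => by
    have := Int.le_of_dvd (by omega) (hc.dvd_of_dvd_mul_right hdvd)
    omega
  have step : ∀ t : ℕ, 0 < t → (t : ℤ) < p → g ((t : ℤ) * q % p) = g (q % p) := by
    intro t ht
    induction t, ht using Nat.le_induction with
    | base => intro _; simp
    | succ t ht ih =>
      intro htp
      push_cast at htp
      have h0 := Int.emod_nonneg ((t : ℤ) * q) (by omega : p ≠ 0)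
      have h0' := Int.emod_lt_of_pos ((t : ℤ) * q) (by omega : 0 < p)
      have h0'' : (t : ℤ) * q % p ≠ 0 := fun h => hnd t ht (by omega) (Int.dvd_of_emod_eq_zero h)
      have hmod : ((t : ℤ) * q % p + q) % p = ((t + 1 : ℕ) : ℤ) * q % p := by
        rw [Int.emod_add_emod]; push_cast; ring_nf
      have hnd' := hnd (t + 1) (by omega) (by push_cast; omega)
      rw [← ih (by omega)]
      have e1 := h1 ((t : ℤ) * q % p + q) (by omega) (by omega) (fun h => hnd' (by
        rw [Int.dvd_iff_emod_eq_zero, ← hmod]; exact Int.emod_eq_zero_of_dvd h))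
      have e2 := h2 ((t : ℤ) * q % p + q) (by omega) (by omega) (fun h => by
        have := Int.le_of_dvd (by omega) ((dvd_add_left dvd_rfl).1 h)
        omega)
      rw [hmod] at e1
      rw [Int.add_emod_right, Int.emod_eq_of_lt h0 (by omega)] at e2
      rw [← e2, e1]
  have all : ∀ r, 0 < r → r < p → g r = g (q % p) := fun r h0 hr => by
    obtain ⟨t, ht, htr⟩ := exists_mul_emod_eq (by omega) hc h0.le hr
    rw [← htr, step t (by rcases t.eq_zero_or_pos with h | h <;> simp_all) ht]
  rw [all i hi hi', all 1 one_pos hp]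

/-- Two initial op-periods of a prefix of length `p + q` have their greatest common divisor as a
further initial op-period. -/
theorem Per.gcd {f : ℤ → ℤ} {d p q : ℤ} (hd : 0 < d) (hp : 0 < p) (hpq : p < q)
    (hc : IsCoprime p q) (h1 : Per f (d * p) (d * p + d * q))
    (h2 : Per f (d * q) (d * p + d * q)) : Per f d (d * p + d * q) := by
  have hdiv : ∀ a k m, 0 ≤ a → a < d → (d * k + a) / (d * m) = k / m := fun a k m h0 ha => by
    rw [← Int.ediv_ediv_of_nonneg hd.le, add_comm, Int.add_mul_ediv_left _ _ hd.ne',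
      Int.ediv_eq_zero_of_lt h0 ha, zero_add]
  have hmod : ∀ a k m, 0 ≤ a → a < d → (d * k + a) % (d * m) = d * (k % m) + a :=
    fun a k m h0 ha => by
      rw [Int.emod_def, Int.emod_def, hdiv a k m h0 ha]; ring
  have hlt : ∀ a k, a < d → k < p + q → d * k + a < d * p + d * q := fun a k ha hk => by
    nlinarith
  have hnn : ∀ a k, 0 ≤ a → 0 ≤ k → 0 ≤ d * k + a := fun a k ha hk => by positivity
  have hper : ∀ m, Per f (d * m) (d * p + d * q) → ∀ a b, 0 ≤ a → a < d → 0 ≤ b → b < d →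
      ∀ k, 0 ≤ k → k < p + q →
      (f (d * k + a) < f (d * k + b)) = (f (d * (k % m) + a) < f (d * (k % m) + b)) := by
    intro m hm a b ha ha' hb hb' k hk hk'
    have := hm (d * k + a) (d * k + b) (hnn _ _ ha hk) (hlt _ _ ha' hk') (hnn _ _ hb hk)
      (hlt _ _ hb' hk') (by rw [hdiv _ _ _ ha ha', hdiv _ _ _ hb hb'])
    rw [hmod _ _ _ ha ha', hmod _ _ _ hb hb'] at this
    exact propext this
  intro i j hi him hj hjm hij
  have hk : 0 ≤ i / d := Int.ediv_nonneg hi hd.le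
  have hk' : i / d < p + q := Int.ediv_lt_of_lt_mul hd (by linarith)
  have ha := Int.emod_nonneg i hd.ne'
  have ha' := Int.emod_lt_of_pos i hd
  have hb := Int.emod_nonneg j hd.ne'
  have hb' := Int.emod_lt_of_pos j hd
  have key := eq_zero_of_coprime_periods
    (g := fun k => f (d * k + i % d) < f (d * k + j % d)) hp hpq hc
    (fun k h0 h => hper p h1 _ _ ha ha' hb hb' k h0 h)
    (fun k h0 h => hper q h2 _ _ ha ha' hb hb' k h0 h) hk hk'
  simp only [mul_zero, zero_add] at key
  rw [← key, Int.mul_ediv_add_emod, hij, Int.mul_ediv_add_emod]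

/-- A step inside a block is of the same kind as the corresponding step inside the first block. -/
theorem Per.sameCmp {f : ℤ → ℤ} {p m i : ℤ} (hp : 0 < p) (h : Per f p m) (hi : 0 < i) (him : i < m)
    (hpi : ¬ p ∣ i) : SameCmp f (i - 1) i (i % p - 1) (i % p) := by
  have h0 : 0 < i % p := (Int.emod_nonneg i hp.ne').lt_of_ne
    fun h => hpi (Int.dvd_of_emod_eq_zero h.symm)
  have h1 := Int.emod_lt_of_pos i hp
  have e : i - 1 = (i % p - 1) + p * (i / p) := by
    have := Int.emod_add_mul_ediv i p
    omega
  have hdiv : (i - 1) / p = i / p := by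
    rw [e, Int.add_mul_ediv_left _ _ hp.ne', Int.ediv_eq_zero_of_lt (by omega) (by omega), zero_add]
  have hmod : (i - 1) % p = i % p - 1 := by
    rw [e, Int.add_mul_emod_self_left, Int.emod_eq_of_lt (by omega) (by omega)]
  have a1 := h (i - 1) i (by omega) (by omega) hi.le him hdiv
  have a2 := h i (i - 1) hi.le him (by omega) (by omega) hdiv.symm
  rw [hmod] at a1 a2
  exact ⟨a1, a2⟩

/-- If `p` is an initial op-period of a prefix of length `p + q` but no number in `(1, p]` is an
initial op-period of the whole string, then neither is `q`. -/
theorem not_per_of_per_prefix {f : ℤ → ℤ} {n p q b m : ℤ} (hb : 0 < b) (hbp : b < p)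
    (hbreak : IsBreak f b) (hpq : p < q) (hm : p + q ≤ m) (hmn : m ≤ n) (h : Per f p m)
    (hno : ∀ d, 1 < d → d ≤ p → ¬ Per f d n) : ¬ Per f q n := by
  intro hq
  have hp : 0 < p := by omega
  obtain ⟨d, p', q', hd, hc, rfl, rfl⟩ :
      ∃ d p' q' : ℤ, 0 < d ∧ IsCoprime p' q' ∧ p = d * p' ∧ q = d * q' := by
    have hg : 0 < Int.gcd p q := Int.gcd_pos_of_ne_zero_left _ hp.ne'
    refine ⟨Int.gcd p q, p / Int.gcd p q, q / Int.gcd p q, by exact_mod_cast hg, ?_, ?_, ?_⟩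
    · exact Int.isCoprime_iff_gcd_eq_one.2 (Int.gcd_ediv_gcd_ediv_gcd hg)
    · rw [Int.mul_ediv_cancel' (Int.gcd_dvd_left ..)]
    · rw [Int.mul_ediv_cancel' (Int.gcd_dvd_right ..)]
  have hp' : 0 < p' := pos_of_mul_pos_right hp hd.le
  have hpq' : p' < q' := lt_of_mul_lt_mul_left hpq hd.le
  by_cases hd1 : d = 1
  · subst hd1
    simp only [one_mul] at *
    have key := eq_one_of_coprime_periods
      (g := fun i => (f (i - 1) < f i, f i < f (i - 1))) (by omega) hpq hc
      (fun i h0 hi hpi => by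
        have := h.sameCmp hp h0 (by omega) hpi
        exact Prod.ext (propext this.1) (propext this.2))
      (fun i h0 hi hqi => by
        have := hq.sameCmp (by omega) h0 (by omega) hqi
        exact Prod.ext (propext this.1) (propext this.2)) hb hbp
    rw [Prod.ext_iff] at key
    have k1 := key.1
    have k2 := key.2
    dsimp only at k1 k2
    rw [sub_self] at k1 k2
    exact hbreak ⟨by rw [k1], by rw [k2]⟩
  · have hper := Per.gcd hd hp' hpq' hc (h.mono hm) (hq.mono (by omega))
    exact hno d (by omega) (le_mul_of_one_le_right hd.le hp')
      (Per.of_dvd hd (by omega) (Dvd.intro _ rfl) hq (hper.mono (by omega)))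

/-- If all breaks are multiples of `p`, then the string is monotone within each block, in the same
direction for all blocks. -/
theorem Per.of_dvd_breaks {f : ℤ → ℤ} {n p : ℤ} (hp : 0 < p)
    (h : ∀ b, 0 < b → b < n → IsBreak f b → p ∣ b) : Per f p n := by
  have key : ∀ i k : ℤ, ∀ t : ℕ, 0 ≤ i → i + (t + 1) < n → p * k ≤ i → i + (t + 1) < p * k + p →
      SameCmp f 0 1 i (i + (t + 1)) := by
    intro i k t hi hn hk hk'
    have hstep : ∀ x, 0 < x → x < n → p * k < x → x < p * k + p → SameCmp f 0 1 (x - 1) x := by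
      intro x hx hxn h1 h2
      by_contra hcon
      obtain ⟨e, rfl⟩ := h x hx hxn hcon
      have h3 : k < e := lt_of_mul_lt_mul_left h1 hp.le
      have h4 : e < k + 1 := lt_of_mul_lt_mul_left (by linarith) hp.le
      omega
    induction t with
    | zero =>
      have := hstep (i + 1) (by omega) (by simpa using hn) (by omega) (by simpa using hk')
      simpa using this
    | succ t ih =>
      push_cast at hn hk' ⊢
      have h1 := ih (by omega) (by omega)
      have h2 := hstep (i + (t + 1) + 1) (by omega) (by omega) (by omega) (by omega)
      rw [add_sub_cancel_right] at h2
      rw [← add_assoc]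
      unfold SameCmp at *
      omega
  have key' : ∀ i j, 0 ≤ i → i < j → j < n → i / p = j / p → SameCmp f 0 1 i j := by
    intro i j hi hij hj hdiv
    have e1 := Int.mul_ediv_add_emod i p
    have e2 := Int.mul_ediv_add_emod j p
    have e3 := Int.emod_nonneg i hp.ne'
    have e4 := Int.emod_lt_of_pos j hp
    have := key i (i / p) (j - i - 1).toNat hi (by omega) (by omega) (by rw [← hdiv] at e2; omega)
    rwa [Int.toNat_of_nonneg (by omega), show i + (j - i - 1 + 1) = j by ring] at this
  have key'' : ∀ i j, 0 ≤ i → i < j → j < n → i / p = j / p →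
      SameCmp f i j (i % p) (j % p) := by
    intro i j hi hij hj hdiv
    have e1 := Int.mul_ediv_add_emod i p
    have e2 := Int.mul_ediv_add_emod j p
    have e3 := Int.emod_nonneg i hp.ne'
    have e4 := Int.emod_lt_of_pos j hp
    have e5 := Int.mul_nonneg hp.le (Int.ediv_nonneg hi hp.le)
    rw [← hdiv] at e2
    have h1 := key' i j hi hij hj hdiv
    have h2 := key' (i % p) (j % p) e3 (by omega) (by omega) (by
      rw [Int.ediv_eq_zero_of_lt e3 (by omega), Int.ediv_eq_zero_of_lt (by omega) e4])
    unfold SameCmp at *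
    omega
  intro i j hi him hj hjm hij
  rcases lt_trichotomy i j with hlt | rfl | hlt
  · exact (key'' i j hi hlt hjm hij).1
  · simp
  · exact (key'' j i hj hlt him hij.symm).2

/-- If the first block has no break inside, then all breaks are at the ends of blocks. -/
theorem Per.dvd_of_isBreak {f : ℤ → ℤ} {n p : ℤ} (hp : 0 < p) (h : Per f p n)
    (hno : ∀ b, 0 < b → b < p → ¬ IsBreak f b) {b : ℤ} (hb : 0 < b) (hbn : b < n)
    (hbreak : IsBreak f b) : p ∣ b := by
  by_contra hpb
  have h1 := h.sameCmp hp hb hbn hpb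
  have h0 : 0 < b % p := (Int.emod_nonneg b hp.ne').lt_of_ne
    fun h => hpb (Int.dvd_of_emod_eq_zero h.symm)
  have h2 := hno (b % p) h0 (Int.emod_lt_of_pos b hp)
  unfold IsBreak SameCmp at *
  omega

/-! ### Initial op-periods in terms of order shapes of blocks -/

/-- A string of rational numbers that is order-equivalent to a prefix of `Y` can be extended to one
that is order-equivalent to `Y`. -/
theorem exists_orderEquiv_append (Y : List ℚ) : ∀ (X : List ℚ), X.length ≤ Y.length →
    OrderEquiv X (Y.take X.length) → ∃ Z, OrderEquiv (X ++ Z) Y := by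
  suffices H : ∀ (m : ℕ) (X : List ℚ), X.length + m = Y.length →
      OrderEquiv X (Y.take X.length) → ∃ Z, OrderEquiv (X ++ Z) Y from
    fun X hX h => H (Y.length - X.length) X (by omega) h
  intro m
  induction m with
  | zero =>
    intro X hX h
    rw [List.take_of_length_le (by omega)] at h
    exact ⟨[], by simpa using h⟩
  | succ m ih =>
    intro X hX h
    have hlt : X.length < Y.length := by omega
    have h' : ∀ i j (hi : i < X.length) (hj : j < X.length), X[i] < X[j] ↔ Y[i] < Y[j] :=
      fun i j hi hj => by
        have := h.2 i j hi hj (by simp; omega) (by simp; omega)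
        simpa using this
    obtain ⟨x, hx1, hx2⟩ : ∃ x : ℚ,
        (∀ i (hi : i < X.length), X[i] < x ↔ Y[i] < Y[X.length]) ∧
        ∀ i (hi : i < X.length), x < X[i] ↔ Y[X.length] < Y[i] := by
      by_cases hex : ∃ i, ∃ hi : i < X.length, Y[i] = Y[X.length]
      · obtain ⟨i, hi, he⟩ := hex
        exact ⟨X[i], fun j hj => by rw [h' j i hj hi, he], fun j hj => by rw [h' i j hi hj, he]⟩
      · push Not at hex
        let lo : Finset ℚ :=
          (Finset.univ.filter fun i : Fin X.length => Y[i] < Y[X.length]).image fun i => X[i]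
        let up : Finset ℚ :=
          (Finset.univ.filter fun i : Fin X.length => Y[X.length] < Y[i]).image fun i => X[i]
        obtain ⟨x, hlo, hup⟩ := Order.exists_between_finsets lo up (by
          simp only [lo, up, Finset.mem_image, Finset.mem_filter, Finset.mem_univ, true_and]
          rintro _ ⟨i, hi, rfl⟩ _ ⟨j, hj, rfl⟩
          exact (h' i j i.2 j.2).2 (hi.trans hj))
        have hlo' : ∀ i (hi : i < X.length), Y[i] < Y[X.length] → X[i] < x := fun i hi hy =>
          hlo _ (Finset.mem_image.2 ⟨⟨i, hi⟩, by simpa using hy, rfl⟩)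
        have hup' : ∀ i (hi : i < X.length), Y[X.length] < Y[i] → x < X[i] := fun i hi hy =>
          hup _ (Finset.mem_image.2 ⟨⟨i, hi⟩, by simpa using hy, rfl⟩)
        refine ⟨x, fun i hi => ⟨fun hx => ?_, hlo' i hi⟩, fun i hi => ⟨fun hx => ?_, hup' i hi⟩⟩
        · by_contra hcon
          exact absurd (hup' i hi ((not_lt.1 hcon).lt_of_ne (hex i hi).symm)) hx.not_gt
        · by_contra hcon
          exact absurd (hlo' i hi ((not_lt.1 hcon).lt_of_ne (hex i hi))) hx.not_gt
    obtain ⟨Z, hZ⟩ := ih (X ++ [x]) (by simp; omega) (by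
      refine ⟨by simp; omega, fun i j hi hj _ _ => ?_⟩
      simp only [List.length_append, List.length_singleton] at hi hj
      rw [List.getElem_take, List.getElem_take]
      rcases Nat.lt_succ_iff_lt_or_eq.1 hi with hi | rfl <;>
        rcases Nat.lt_succ_iff_lt_or_eq.1 hj with hj | rfl
      · simpa [List.getElem_append_left, hi, hj] using h' i j hi hj
      · simpa [List.getElem_append_left, hi] using hx1 i hi
      · simpa [List.getElem_append_left, hj] using hx2 j hj
      · simp)
    exact ⟨x :: Z, by simpa using hZ⟩

/-- The letters of a string, as a function on the integers with the value `0` outside the string. -/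
def letters (S : List ℤ) (i : ℤ) : ℤ := if 0 ≤ i then S.getD i.toNat 0 else 0

theorem letters_natCast (S : List ℤ) {i : ℕ} (hi : i < S.length) : letters S i = S[i] := by
  simp [letters, hi]

theorem getElem_flatten_of_length {α : Type*} {p : ℕ} : ∀ {Vs : List (List α)},
    (∀ V ∈ Vs, V.length = p) → ∀ (i k : ℕ), i < p → (h : k < Vs.length) →
    Vs.flatten[p * k + i]? = Vs[k][i]?
  | [], _, _, _, _, h => absurd h (by simp)
  | V :: Vs, hV, i, 0, hi, _ => by
    have := hV V (by simp)
    simp [List.getElem?_append_left, this, hi]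
  | V :: Vs, hV, i, k + 1, hi, h => by
    have h1 := hV V (by simp)
    have ih := getElem_flatten_of_length (Vs := Vs)
      (fun W hW => hV W (List.mem_cons_of_mem _ hW)) i k hi
      (by simpa using h)
    rw [List.flatten_cons, List.getElem?_append_right (by rw [h1, mul_add]; omega), h1,
      show p * (k + 1) + i - p = p * k + i by rw [mul_add]; omega, ih]
    rfl

theorem length_flatten_of_length {α : Type*} {p : ℕ} {Vs : List (List α)}
    (h : ∀ V ∈ Vs, V.length = p) : Vs.flatten.length = p * Vs.length := by
  rw [List.length_flatten, List.eq_replicate_of_mem (a := p) (l := Vs.map List.length)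
    (by simpa using h)]
  simp [mul_comm]

/-- The converse needs a completion of the last block by rational letters, which exists since the order
of the rational numbers is dense. -/
theorem isInitialOpPeriod_iff {S : List ℤ} {p : ℕ} :
    IsInitialOpPeriod S p ↔ 0 < p ∧ p < S.length ∧ Per (letters S) p S.length := by
  constructor
  · rintro ⟨hp, hpn, V₁, Vs, hlen, heq, -, hpre⟩
    refine ⟨hp, hpn, fun i j hi him hj hjm hij => ?_⟩
    lift i to ℕ using hi
    lift j to ℕ using hj
    norm_cast at him hjm hij ⊢
    rw [List.drop_zero] at hpre
    have hlen' : ∀ V ∈ Vs, V.length = p := fun V hV => hlen V (by simp [hV])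
    have hn := hpre.length_le
    rw [length_flatten_of_length hlen', List.length_map] at hn
    have hk : ∀ i < S.length, i / p < Vs.length := fun i hi =>
      Nat.div_lt_of_lt_mul (lt_of_lt_of_le hi hn)
    have hmod : ∀ i, i % p < p := fun i => Nat.mod_lt _ hp
    have hget : ∀ i (hi : i < S.length),
        (S[i] : ℚ) = (Vs[i / p]'(hk i hi))[i % p]'(by
          rw [hlen' _ (List.getElem_mem _)]; exact hmod i) := fun i hi => by
      have h1 := getElem_flatten_of_length hlen' (i % p) (i / p) (hmod i) (hk i hi)
      have h2 := hpre.getElem (i := i) (by simpa using hi)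
      have hL : i < Vs.flatten.length := by
        rw [length_flatten_of_length hlen']; omega
      have hR : i % p < (Vs[i / p]'(hk i hi)).length := by
        rw [hlen' _ (List.getElem_mem _)]; exact hmod i
      rw [List.getElem_map] at h2
      rw [Nat.div_add_mod, List.getElem?_eq_getElem hL, List.getElem?_eq_getElem hR,
        Option.some.injEq, ← h2] at h1
      exact h1
    have hmp := hmod i
    have hmp' := hmod j
    have h0 : 0 < Vs.length :=
      (Nat.zero_le _).trans_lt (hk i him)
    have key := (heq (Vs[i / p]'(hk i him)) (by simp) (Vs[0]'h0) (by simp)).2 (i % p) (j % p)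
      (by rw [hlen' _ (List.getElem_mem _)]; omega) (by rw [hlen' _ (List.getElem_mem _)]; omega)
      (by rw [hlen' _ (List.getElem_mem _)]; omega) (by rw [hlen' _ (List.getElem_mem _)]; omega)
    have g1 := hget i him
    have g2 := hget j hjm
    have g3 := hget (i % p) (by omega)
    have g4 := hget (j % p) (by omega)
    simp only [← hij] at g2
    simp only [Nat.div_eq_of_lt, hmp, hmp', Nat.mod_mod] at g3 g4
    rw [← g1, ← g2, ← g3, ← g4, Int.cast_lt, Int.cast_lt] at key
    rwa [letters_natCast _ him, letters_natCast _ hjm, letters_natCast _ (by omega),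
      letters_natCast _ (by omega)]
  · rintro ⟨hp, hpn, hper⟩
    set T : List ℚ := S.map (fun x : ℤ => (x : ℚ)) with hT
    have hTl : T.length = S.length := by simp [T]
    have hTlt : ∀ i j (hi : i < T.length) (hj : j < T.length),
        T[i] < T[j] ↔ letters S i < letters S j := fun i j hi hj => by
      rw [letters_natCast _ (by omega), letters_natCast _ (by omega)]
      simp [T]
    -- A block of the decomposition: the letters of `S`, completed if necessary.
    have hblock : ∀ k : ℕ, ∃ Z, p * k ≤ T.length →
        OrderEquiv ((T.drop (p * k)).take p ++ Z) (T.take p) := by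
      intro k
      by_cases hk : p * k ≤ T.length
      · obtain ⟨Z, hZ⟩ := exists_orderEquiv_append (T.take p) ((T.drop (p * k)).take p)
          (by simp) (by
            refine ⟨by simp, fun i j hi hj _ _ => ?_⟩
            simp only [List.length_take, List.length_drop, lt_min_iff] at hi hj
            simp only [List.getElem_take, List.getElem_drop]
            rw [hTlt, hTlt]
            have := hper ((p * k + i : ℕ) : ℤ) ((p * k + j : ℕ) : ℤ) (by positivity)
              (by norm_cast; omega) (by positivity) (by norm_cast; omega) (by
                norm_cast
                rw [Nat.mul_add_div hp, Nat.mul_add_div hp, Nat.div_eq_of_lt hi.1,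
                  Nat.div_eq_of_lt hj.1])
            norm_cast at this
            rw [Nat.mul_add_mod, Nat.mul_add_mod, Nat.mod_eq_of_lt hi.1,
              Nat.mod_eq_of_lt hj.1] at this
            exact this)
        exact ⟨Z, fun _ => hZ⟩
      · exact ⟨[], fun h => absurd h hk⟩
    choose Z hZ using hblock
    have htrans : ∀ {X Y W : List ℚ}, OrderEquiv X Y → OrderEquiv W Y → OrderEquiv X W := by
      intro X Y W h1 h2
      refine ⟨h1.1.trans h2.1.symm, fun i j hi hj hi' hj' => ?_⟩
      rw [h1.2 i j hi hj (h1.1 ▸ hi) (h1.1 ▸ hj), h2.2 i j hi' hj' (h1.1 ▸ hi) (h1.1 ▸ hj)]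
    have hself : OrderEquiv (T.take p) (T.take p) := ⟨rfl, fun _ _ _ _ _ _ => Iff.rfl⟩
    let Vs := (List.range (S.length / p + 1)).map fun k => (T.drop (p * k)).take p ++ Z k
    have hall : ∀ V ∈ T.take p :: Vs, OrderEquiv V (T.take p) := by
      intro V hV
      rcases List.mem_cons.1 hV with rfl | hV
      · exact hself
      · obtain ⟨k, hk, rfl⟩ := List.mem_map.1 hV
        refine hZ k ?_
        rw [List.mem_range] at hk
        rw [hTl]
        calc p * k ≤ p * (S.length / p) := Nat.mul_le_mul_left _ (by omega)
          _ ≤ S.length := Nat.mul_div_le _ _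
    refine ⟨hp, hpn, T.take p, Vs, fun V hV => ?_, fun V hV W hW => htrans (hall V hV) (hall W hW),
      by simp, ?_⟩
    · rw [(hall V hV).1, List.length_take]; omega
    · have hVs : ∀ m, m ≤ S.length / p → T.take (p * m) ++ (T.drop (p * m)).take p <+:
          ((List.range (m + 1)).map fun k => (T.drop (p * k)).take p ++ Z k).flatten := by
        intro m hm
        have hfull : ∀ k, k < S.length / p → Z k = [] := by
          intro k hk
          have hle : p * (k + 1) ≤ S.length :=
            (Nat.mul_le_mul_left _ hk).trans (Nat.mul_div_le _ _)
          rw [mul_add] at hle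
          have := (hZ k (by omega)).1
          simp only [List.length_append, List.length_take, List.length_drop] at this
          exact List.length_eq_zero_iff.1 (by omega)
        have hflat : ∀ m, m ≤ S.length / p →
            ((List.range m).map fun k => (T.drop (p * k)).take p ++ Z k).flatten =
              T.take (p * m) := by
          intro m
          induction m with
          | zero => simp
          | succ m ih =>
            intro hm
            rw [List.range_succ, List.map_append, List.flatten_append, ih (by omega)]
            simp [hfull m (by omega), mul_add, List.take_add]
        rw [List.range_succ, List.map_append, List.flatten_append, hflat m hm]
        simp
      have := hVs _ le_rfl
      rw [← List.take_add, List.take_of_length_le (by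
        rw [hTl]
        have := Nat.div_add_mod S.length p
        have := Nat.mod_lt S.length hp
        omega)] at this
      simpa using this

/-! ### Sorting the positions of the string -/

local infixr:40 ";;" => Cmd.seq
local infix:50 ":=:" => Cmd.assign
local notation "cst" => Expr.const
local notation "rg" => Expr.reg
local notation "rd" => Expr.read

/-- The position in register `4` is entered into array `1`, and its letter is taken into account for the
maximum in register `1`. -/
def prepBody : Cmd :=
  Cmd.ite ((rd 0 (rg 4)).lt (cst 0)) (5 :=: cst 0 - rd 0 (rg 4)) (5 :=: rd 0 (rg 4)) ;;
  Cmd.ite ((rg 1).lt (rg 5)) (1 :=: rg 5) Cmd.skip ;;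
  Cmd.write 1 (rg 4) (rg 4) ;;
  4 :=: rg 4 + cst 1

/-- Register `0` holds the length `n`. Register `1` becomes the largest absolute value of a letter,
register `2` the base `n + 2`, and array `1` the list of all positions. -/
def prep : Cmd :=
  (2 :=: rg 0 + cst 2 ;; 1 :=: cst 0 ;; 4 :=: cst 0) ;; .loop ((rg 4).lt (rg 0)) prepBody

theorem within_prep {B : ℕ} {σ : State} {n D : ℤ} {f : ℤ → ℤ} (hn : 0 ≤ n) (hB : n + 2 ≤ B)
    (h0 : σ.reg 0 = n) (hf : σ.arr 0 = f) (hDB : D ≤ B)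
    (hD : ∀ i, 0 ≤ i → i < n → |f i| ≤ D) (hD0 : 0 ≤ D) :
    Within B prep σ (50 * (n.toNat + 2)) fun τ => τ.reg 2 = n + 2 ∧ 0 ≤ τ.reg 1 ∧ τ.reg 1 ≤ D ∧
      (∀ i, 0 ≤ i → i < n → |f i| ≤ τ.reg 1) ∧ ∀ i, 0 ≤ i → i < n → τ.arr 1 i = i := by
  have hB1 : 1 ≤ B := by omega
  simp only [abs_le] at *
  refine (Within.seq_loop 50
    (I := fun τ => τ.reg 2 = n + 2 ∧ 0 ≤ τ.reg 1 ∧ τ.reg 1 ≤ D ∧ 0 ≤ τ.reg 4 ∧ τ.reg 4 ≤ n ∧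
      (∀ i, 0 ≤ i → i < τ.reg 4 → -τ.reg 1 ≤ f i ∧ f i ≤ τ.reg 1) ∧
      ∀ i, 0 ≤ i → i < τ.reg 4 → τ.arr 1 i = i)
    (φ := fun τ => (n - τ.reg 4).toNat) (N := n.toNat) (by decide) (by decide)
    ?_ fun τ hI hF => ?_).mono le_rfl ?_
  · simp [Cmd.wp, h0, abs_le]
    grind
  · have e0 : τ.reg 0 = n := by rw [hF.1 0 (by decide), h0]
    have ef : τ.arr 0 = f := by rw [hF.2 0 (by decide), hf]
    obtain ⟨r2, r1, r1', r4, r4', r5, r6⟩ := hI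
    refine ⟨by simp [hB1], fun hlt => ?_⟩
    have hf' := hD (τ.reg 4)
    simp [prepBody, Cmd.wp, hB1, e0, ef, Function.update_apply, abs_le] at hlt ⊢
    and_intros <;> intros <;> and_intros <;> intros <;> and_intros <;> grind
  · rintro τ ⟨h, hv⟩ hF
    have e0 : τ.reg 0 = n := by rw [hF.1 0 (by decide), h0]
    simp [e0] at hv
    grind

/-- `h` is the head of a linked list with the entries `l`, where `nx` gives the next entry
and `-1` marks the end. -/
def Chain (nx : ℤ → ℤ) : ℤ → List ℤ → Prop
  | h, [] => h = -1
  | h, x :: l => h = x ∧ Chain nx (nx x) l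

theorem Chain.update {nx : ℤ → ℤ} {i v : ℤ} : ∀ {l : List ℤ} {h : ℤ}, i ∉ l → Chain nx h l →
    Chain (Function.update nx i v) h l
  | [], _, _, hc => hc
  | x :: l, h, hi, hc => by
    simp only [List.mem_cons, not_or] at hi
    refine ⟨hc.1, ?_⟩
    rw [Function.update_of_ne (Ne.symm hi.1)]
    exact Chain.update hi.2 hc.2

/-- The cells `A 0, A 1, …` hold the entries of `l`. -/
def Lists (A : ℤ → ℤ) (l : List ℤ) : Prop := ∀ (k : ℕ) (hk : k < l.length), A k = l[k]

theorem Lists.snoc {A : ℤ → ℤ} {l : List ℤ} {x : ℤ} (h : Lists A l) :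
    Lists (Function.update A l.length x) (l ++ [x]) := by
  intro k hk
  simp only [List.length_append, List.length_singleton] at hk
  rcases Nat.lt_succ_iff_lt_or_eq.1 hk with hk | rfl
  · rw [Function.update_of_ne (by exact_mod_cast hk.ne), List.getElem_append_left hk, h k hk]
  · simp

/-- The effect of the insertion of `i` at the head of the bucket `dig i`, where `hd` gives the heads of
the buckets. -/
theorem Chain.push {nx hd : ℤ → ℤ} {l : List ℤ} {i b : ℤ} {dig : ℤ → ℤ} (hi : i ∉ l)
    (h : ∀ d, 0 ≤ d → d < b → Chain nx (hd d) (l.filter (dig · = d))) (d : ℤ) (h0 : 0 ≤ d)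
    (hb : d < b) : Chain (Function.update nx i (hd (dig i))) (Function.update hd (dig i) i d)
      ((i :: l).filter (dig · = d)) := by
  have hi' : ∀ d, i ∉ l.filter (dig · = d) := fun d hm => hi (List.mem_of_mem_filter hm)
  by_cases hd : d = dig i
  · subst hd
    rw [List.filter_cons_of_pos (by simp), Function.update_self]
    refine ⟨rfl, ?_⟩
    rw [Function.update_self]
    exact (h _ h0 hb).update (hi' _)
  · rw [List.filter_cons_of_neg (by simpa using Ne.symm hd), Function.update_of_ne hd]
    exact (h d h0 hb).update (hi' d)

/-- All buckets (array `2`) become empty. -/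
def clear : Cmd :=
  5 :=: cst 0 ;; .loop ((rg 5).lt (rg 2)) (Cmd.write 2 (rg 5) (cst (-1)) ;; 5 :=: rg 5 + cst 1)

theorem within_clear {B : ℕ} {σ : State} {b : ℤ} (hb : 0 ≤ b) (hB : b + 1 ≤ B)
    (h2 : σ.reg 2 = b) :
    Within B clear σ (20 * (b.toNat + 2)) fun τ => ∀ d, 0 ≤ d → d < b → τ.arr 2 d = -1 := by
  have hB1 : 1 ≤ B := by omega
  refine (Within.seq_loop 20
    (I := fun τ => 0 ≤ τ.reg 5 ∧ τ.reg 5 ≤ b ∧ ∀ d, 0 ≤ d → d < τ.reg 5 → τ.arr 2 d = -1)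
    (φ := fun τ => (b - τ.reg 5).toNat) (N := b.toNat) (by decide) (by decide)
    ?_ fun τ hI hF => ?_).mono le_rfl ?_
  · simp [Cmd.wp]
    grind
  · have e2 : τ.reg 2 = b := by rw [hF.1 2 (by decide), h2]
    refine ⟨by simp [hB1], fun hlt => ?_⟩
    simp [Cmd.wp, e2, Function.update_apply, abs_le] at hlt ⊢
    grind
  · rintro τ ⟨h, hv⟩ hF
    have e2 : τ.reg 2 = b := by rw [hF.1 2 (by decide), h2]
    simp [e2] at hv
    grind

/-- The positions listed in array `1` are put into the buckets that belong to their current digits;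
array `3` links the positions in a bucket. The list is read from its end, so that its order is kept
within each bucket. -/
def distribute : Cmd :=
  6 :=: rg 0 ;; .loop ((cst 0).lt (rg 6))
    (6 :=: rg 6 - cst 1 ;; 4 :=: rd 1 (rg 6) ;;
     5 :=: ((rd 0 (rg 4) + rg 1) / rg 3) % rg 2 ;;
     Cmd.write 3 (rg 4) (rd 2 (rg 5)) ;; Cmd.write 2 (rg 5) (rg 4))

theorem within_distribute {B : ℕ} {σ : State} {n b M w : ℤ} {f : ℤ → ℤ} {l : List ℤ}
    (hn : 0 ≤ n) (hb : 0 < b) (hw : 0 < w) (hnB : n + 1 ≤ B) (hMB : 2 * M ≤ B)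
    (h0 : σ.reg 0 = n) (h1 : σ.reg 1 = M) (h2 : σ.reg 2 = b) (h3 : σ.reg 3 = w)
    (hf : σ.arr 0 = f) (hM : ∀ x ∈ l, |f x| ≤ M) (hl : Lists (σ.arr 1) l) (hln : l.length = n)
    (hnd : l.Nodup) (hcl : ∀ d, 0 ≤ d → d < b → σ.arr 2 d = -1) :
    Within B distribute σ (100 * (n.toNat + 2)) fun τ => ∀ d, 0 ≤ d → d < b →
      Chain (τ.arr 3) (τ.arr 2 d) (l.filter fun x => (f x + M) / w % b = d) := by
  have hB1 : 1 ≤ B := by omega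
  refine (Within.seq_loop 100
    (I := fun τ => ∃ k : ℕ, τ.reg 6 = k ∧ k ≤ n ∧ ∀ d, 0 ≤ d → d < b →
      Chain (τ.arr 3) (τ.arr 2 d) ((l.drop k).filter fun x => (f x + M) / w % b = d))
    (φ := fun τ => (τ.reg 6).toNat) (N := n.toNat) (by decide) (by decide)
    ?_ fun τ hI hF => ?_).mono le_rfl ?_
  · simp only [Cmd.wp, Expr.ok_reg, true_and, Expr.val_reg, h0, State.reg_setReg, if_true, le_refl,
      and_true]
    refine ⟨n.toNat, by omega, by omega, fun d hd hd' => ?_⟩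
    rw [List.drop_of_length_le (by omega)]
    exact hcl d hd hd'
  · have e0 : τ.reg 0 = n := by rw [hF.1 0 (by decide), h0]
    have e1 : τ.reg 1 = M := by rw [hF.1 1 (by decide), h1]
    have e2 : τ.reg 2 = b := by rw [hF.1 2 (by decide), h2]
    have e3 : τ.reg 3 = w := by rw [hF.1 3 (by decide), h3]
    have ef : τ.arr 0 = f := by rw [hF.2 0 (by decide), hf]
    have el : τ.arr 1 = σ.arr 1 := hF.2 1 (by decide)
    obtain ⟨k, ek, hkn, hc⟩ := hI
    refine ⟨by simp [hB1], fun hlt => ?_⟩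
    rcases k with _ | k
    · simp [ek] at hlt
    have hk : k < l.length := by omega
    have ei : σ.arr 1 (τ.reg 6 - 1) = l[k] := by rw [ek]; simpa using hl k hk
    have hfi := abs_le.1 (hM l[k] (List.getElem_mem hk))
    have hq0 : 0 ≤ (f l[k] + M) / w := Int.ediv_nonneg (by omega) hw.le
    have hq1 : (f l[k] + M) / w ≤ f l[k] + M := Int.ediv_le_self _ (by omega)
    simp only [Cmd.wp, Expr.ok_sub, Expr.ok_reg, Expr.ok_const, true_and, Expr.val_sub,
      Expr.val_reg, Expr.val_const, Expr.ok_read, Expr.val_read, State.arr_setReg, State.reg_setReg,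
      if_true, el, ei, State.reg_setArr, State.arr_setArr]
    simp [e1, e2, e3, ef]
    refine ⟨⟨hB1, ?_⟩, Expr.ok_mod ?_ ?_ ?_ ?_ ?_, ⟨k, by omega, by omega, ?_⟩, by omega⟩
    · rw [abs_le]; omega
    · simp [e1, e3, ef]
      rw [abs_le, abs_le]; omega
    · simp
    · simpa [e1, e3, ef] using hq0
    · simp [e1, e3, ef]; omega
    · simp [e2, hb.le]
    · rw [List.drop_eq_getElem_cons hk]
      have hnd' := hnd.sublist (List.drop_sublist k l)
      rw [List.drop_eq_getElem_cons hk] at hnd'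
      exact Chain.push (List.nodup_cons.1 hnd').1 hc
  · rintro τ ⟨⟨k, ek, hkn, hc⟩, hv⟩ hF
    simp [ek] at hv
    subst hv
    simpa using hc

/-- The buckets are concatenated in array `1`. Each iteration either moves one entry or goes on to the
next bucket; register `5` is the bucket, `6` the number of entries written, `7` the current entry. -/
def collect : Cmd :=
  (5 :=: cst 0 ;; 6 :=: cst 0 ;; 7 :=: rd 2 (cst 0)) ;; .loop ((rg 5).lt (rg 2))
    (.ite ((cst (-1)).lt (rg 7))
      (Cmd.write 1 (rg 6) (rg 7) ;; 6 :=: rg 6 + cst 1 ;; 7 :=: rd 3 (rg 7))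
      (5 :=: rg 5 + cst 1 ;; 7 :=: rd 2 (rg 5)))

/-- The invariant of `collect`: when `k` entries have been written to `A` and the linked list with the
head `cur` is what remains of bucket `d`, the written entries, this list, and the further buckets make
up the concatenation of all buckets. -/
def CollectInv (b : ℕ) (bk : ℕ → List ℤ) (nx : ℤ → ℤ) (d k cur : ℤ) (A : ℤ → ℤ) : Prop :=
  ∃ (e : ℕ) (pre todo : List ℤ), d = e ∧ e ≤ b ∧ k = pre.length ∧
    pre ++ (todo ++ ((List.range b).drop (e + 1)).flatMap bk) = (List.range b).flatMap bk ∧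
    Lists A pre ∧ (e < b → Chain nx cur todo) ∧ (e = b → todo = []) ∧ ∀ x ∈ todo, 0 ≤ x

theorem within_collect {B : ℕ} {σ : State} {n : ℤ} {b : ℕ} {bk : ℕ → List ℤ}
    (hb : 0 < b) (hnB : n + 1 ≤ B) (hbB : b + 1 ≤ B) (h2 : σ.reg 2 = b)
    (hbk : ∀ d < b, Chain (σ.arr 3) (σ.arr 2 d) (bk d)) (h0 : ∀ d < b, ∀ x ∈ bk d, 0 ≤ x)
    (hlen : ((List.range b).flatMap bk).length = n) :
    Within B collect σ (50 * (n.toNat + b + 2)) fun τ =>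
      Lists (τ.arr 1) ((List.range b).flatMap bk) := by
  have hB1 : 1 ≤ B := by omega
  refine (Within.seq_loop 50
    (I := fun τ => CollectInv b bk (σ.arr 3) (τ.reg 5) (τ.reg 6) (τ.reg 7) (τ.arr 1))
    (φ := fun τ => (n - τ.reg 6).toNat + (b - τ.reg 5).toNat) (N := n.toNat + b) (by decide)
    (by decide) ?_ fun τ hI hF => ?_).mono le_rfl ?_
  · simp [Cmd.wp]
    refine ⟨0, [], bk 0, by simp, by omega, by simp, ?_, ?_, fun _ => hbk 0 hb, by omega, h0 0 hb⟩
    · obtain ⟨b, rfl⟩ := Nat.exists_eq_succ_of_ne_zero hb.ne'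
      simp [List.range_succ_eq_map]
    · simp [Lists]
  · have e2 : τ.reg 2 = b := by rw [hF.1 2 (by decide), h2]
    have eh : τ.arr 2 = σ.arr 2 := hF.2 2 (by decide)
    have en : τ.arr 3 = σ.arr 3 := hF.2 3 (by decide)
    obtain ⟨d, pre, todo, e5, hdb, e6, hR, hA, hc, hend, hnn⟩ := hI
    have hlen' := congrArg List.length hR
    rw [List.length_append, List.length_append] at hlen'
    refine ⟨by simp [hB1], fun hlt => ?_⟩
    simp [e2, e5] at hlt
    simp [Cmd.wp, hB1, eh, en, e5, e6, abs_le]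
    refine ⟨fun h7 => ?_, fun h7 => ?_⟩
    · rcases todo with _ | ⟨x, todo⟩
      · have : τ.reg 7 = -1 := hc hlt
        omega
      · obtain ⟨hx, hc'⟩ := hc hlt
        rw [List.length_cons] at hlen'
        refine ⟨by omega, ⟨d, pre ++ [x], todo, rfl, hdb, by simp, by simpa using hR, ?_,
          fun _ => by rw [hx]; exact hc', fun h => by omega, fun y hy => hnn y (by simp [hy])⟩,
          by omega⟩
        rw [hx]; exact hA.snoc
    · rcases todo with _ | ⟨x, todo⟩
      · refine ⟨by omega, ⟨d + 1, pre, if d + 1 < b then bk (d + 1) else [], by simp, by omega, rfl,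
          ?_, hA, fun h => ?_, fun h => by simp [h], ?_⟩, by omega⟩
        · rw [← hR]
          split_ifs with h
          · rw [List.drop_eq_getElem_cons (i := d + 1) (by simpa using h)]
            simp
          · rw [List.drop_of_length_le (i := d + 1) (by simp; omega),
              List.drop_of_length_le (by simp; omega)]
        · rw [if_pos h]
          simpa using hbk _ h
        · split_ifs with h
          · exact h0 _ h
          · simp
      · have := (hc hlt).1
        have := hnn x (by simp)
        omega
  · rintro τ ⟨⟨d, pre, todo, e5, hdb, e6, hR, hA, hc, hend, hnn⟩, hv⟩ hF
    have e2 : τ.reg 2 = b := by rw [hF.1 2 (by decide), h2]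
    simp [e2, e5] at hv
    have hd : d = b := by omega
    rw [hend hd, List.drop_of_length_le (by simp; omega)] at hR
    simp at hR
    rwa [← hR]

/-- Comparison of positions by the low-order parts modulo `w` of their keys, ties being broken by the
positions themselves. -/
def KeyLt (κ : ℤ → ℤ) (w x y : ℤ) : Prop := κ x % w < κ y % w ∨ κ x % w = κ y % w ∧ x < y

/-- The concatenation of the buckets of `l` with respect to the base-`b` digit of weight `w`. -/
def radixPass (κ : ℤ → ℤ) (w : ℤ) (b : ℕ) (l : List ℤ) : List ℤ :=
  (List.range b).flatMap fun d : ℕ => l.filter fun x => κ x / w % b = (d : ℤ)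

/-- A list of all positions `0, …, n - 1` without repetition. -/
def IsEnum (n : ℤ) (l : List ℤ) : Prop :=
  l.Nodup ∧ (∀ x, x ∈ l ↔ 0 ≤ x ∧ x < n) ∧ l.length = n

theorem emod_mul_eq {w b : ℤ} (hw : 0 < w) (k : ℤ) :
    k % (w * b) = k % w + w * (k / w % b) := by
  rw [Int.emod_def, Int.emod_def, Int.emod_def, Int.ediv_ediv_of_nonneg hw.le]
  ring

/-- A stable distribution by the next digit turns an order by the digits below `w` into an order by the
digits below `w * b`. -/
theorem KeyLt.of_radixPass {κ : ℤ → ℤ} {w : ℤ} {b : ℕ} (hw : 0 < w) {l : List ℤ}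
    (hl : l.Pairwise (KeyLt κ w)) : (radixPass κ w b l).Pairwise (KeyLt κ (w * b)) := by
  unfold radixPass
  rw [List.pairwise_flatMap]
  constructor
  · intro d _
    rw [List.pairwise_filter]
    refine hl.imp fun {x y} hxy hx hy => ?_
    simp only [decide_eq_true_eq] at hx hy
    unfold KeyLt at *
    rw [emod_mul_eq hw, emod_mul_eq hw, hx, hy]
    omega
  · refine List.Pairwise.imp (R := (· < ·)) ?_ List.pairwise_lt_range
    intro d e hde x hx y hy
    have hx' := of_decide_eq_true (List.mem_filter.1 hx).2
    have hy' := of_decide_eq_true (List.mem_filter.1 hy).2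
    left
    rw [emod_mul_eq hw, emod_mul_eq hw, hx', hy']
    have h1 := Int.emod_lt_of_pos (κ x) hw
    have h2 := Int.emod_nonneg (κ y) hw.ne'
    have h3 : w * (d + 1) ≤ w * e := mul_le_mul_of_nonneg_left (by exact_mod_cast hde) hw.le
    linarith

theorem IsEnum.radixPass {κ : ℤ → ℤ} {n w : ℤ} {b : ℕ} (hw : 0 < w) (hb : 0 < b) {l : List ℤ}
    (hl : l.Pairwise (KeyLt κ w)) (h : IsEnum n l) : IsEnum n (radixPass κ w b l) := by
  have hmem : ∀ x, x ∈ OP.radixPass κ w b l ↔ x ∈ l := by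
    intro x
    have hb' : (0 : ℤ) < b := by exact_mod_cast hb
    have h1 := Int.emod_nonneg (κ x / w) hb'.ne'
    have h2 := Int.emod_lt_of_pos (κ x / w) hb'
    simp only [OP.radixPass, List.mem_flatMap, List.mem_range, List.mem_filter, decide_eq_true_eq]
    refine ⟨fun ⟨d, _, hx, _⟩ => hx, fun hx => ⟨(κ x / w % b).toNat, by omega, hx, by omega⟩⟩
  have hnd : (OP.radixPass κ w b l).Nodup :=
    (KeyLt.of_radixPass (b := b) hw hl).imp fun {x y} hxy he => by
      subst he
      unfold KeyLt at hxy
      omega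
  exact ⟨hnd, fun x => (hmem x).trans (h.2.1 x),
    by rw [((List.perm_ext_iff_of_nodup hnd h.1).2 hmem).length_eq, h.2.2]⟩

/-- One round of radix sort: the list in array `1` is sorted stably by the digit of weight `w`,
the contents of register `3`. -/
def radixRound : Cmd := clear ;; distribute ;; collect

theorem within_radixRound {B : ℕ} {σ : State} {n M w : ℤ} {b : ℕ} {f : ℤ → ℤ} {l : List ℤ}
    (hn : 0 ≤ n) (hb : 0 < b) (hw : 0 < w) (hnB : n + 1 ≤ B) (hbB : b + 1 ≤ B) (hMB : 2 * M ≤ B)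
    (h0 : σ.reg 0 = n) (h1 : σ.reg 1 = M) (h2 : σ.reg 2 = b) (h3 : σ.reg 3 = w)
    (hf : σ.arr 0 = f) (hM : ∀ x ∈ l, |f x| ≤ M) (hl : Lists (σ.arr 1) l) (he : IsEnum n l)
    (hs : l.Pairwise (KeyLt (fun x => f x + M) w)) :
    Within B radixRound σ (170 * (n.toNat + b + 2)) fun τ =>
      Lists (τ.arr 1) (radixPass (fun x => f x + M) w b l) := by
  have hb' : (0 : ℤ) < b := by exact_mod_cast hb
  refine Within.mono (Within.seq (within_clear (b := b) (by omega) (by omega) h2) fun τ hτ hF =>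
    Within.seq (within_distribute hn hb' hw hnB hMB (by rw [hF.1 0 (by decide), h0])
      (by rw [hF.1 1 (by decide), h1]) (by rw [hF.1 2 (by decide), h2])
      (by rw [hF.1 3 (by decide), h3]) (by rw [hF.2 0 (by decide), hf]) hM
      (by rw [hF.2 1 (by decide)]; exact hl) he.2.2 he.1 hτ) fun ρ hρ hF' =>
    within_collect (bk := fun d : ℕ => l.filter fun x => (f x + M) / w % b = (d : ℤ)) hb hnB (by omega)
      (by rw [hF'.1 2 (by decide), hF.1 2 (by decide), h2])
      (fun d hd => hρ d (by omega) (by omega))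
      (fun d hd x hx => ((he.2.1 x).1 (List.mem_of_mem_filter hx)).1)
      (he.radixPass (κ := fun x => f x + M) (b := b) hw hb hs).2.2) ?_ fun _ h _ => h
  rw [Int.toNat_natCast]
  omega

/-- The positions are sorted by their letters, ties being broken by the positions themselves. The keys
are the letters increased by their largest absolute value `M` (register `1`), so that they lie between
`0` and `2 * M`; the rounds stop when the weight in register `3` exceeds `2 * M`. -/
def sortPositions : Cmd :=
  prep ;; 3 :=: cst 1 ;;
  .loop ((rg 3).lt (rg 1 + rg 1 + cst 1)) (radixRound ;; 3 :=: rg 3 * rg 2)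

theorem within_sortPositions {B c n : ℕ} {σ : State} {f : ℤ → ℤ}
    (hB : 2 * ((n : ℤ) + 2) ^ (c + 1) + n + 3 ≤ B) (h0 : σ.reg 0 = n) (hf : σ.arr 0 = f)
    (hc : ∀ i, 0 ≤ i → i < (n : ℤ) → |f i| ≤ ((n : ℤ) + 2) ^ c) :
    Within B sortPositions σ ((c + 4) * (400 * (n + 2))) fun τ => ∃ l, IsEnum n l ∧
      Lists (τ.arr 1) l ∧ l.Pairwise fun x y => f x < f y ∨ f x = f y ∧ x < y := by
  have hD0 : (0 : ℤ) < ((n : ℤ) + 2) ^ c := by positivity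
  have hD1 : ((n : ℤ) + 2) ^ (c + 1) = ((n : ℤ) + 2) ^ c * (n + 2) := pow_succ _ _
  have hD2 : ((n : ℤ) + 2) ^ c * 2 ≤ ((n : ℤ) + 2) ^ c * (n + 2) :=
    mul_le_mul_of_nonneg_left (by omega) hD0.le
  have hB1 : 1 ≤ B := by omega
  refine Within.mono (Within.seq (within_prep (n := n) (D := ((n : ℤ) + 2) ^ c) (by omega) (by omega)
    h0 hf (by omega) hc hD0.le) fun τ hτ hF => Within.seq
    (R := fun ρ => ρ = τ.setReg 3 1) (Within.of_wp ?_) fun ρ hρ _ =>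
    Within.mono (T' := (c + 3) * (360 * (n + 2))) (Within.loop (T := 350 * (n + 2))
      (I := fun τ' => 0 < τ'.reg 3 ∧ τ'.reg 3 ≤ 2 * τ.reg 1 * (n + 2) + 1 ∧
        ∃ l, IsEnum n l ∧ Lists (τ'.arr 1) l ∧
          l.Pairwise (KeyLt (fun x => f x + τ.reg 1) (τ'.reg 3)))
      -- The weight is a power of `n + 2` that does not exceed `(n + 2) ^ (c + 2)`.
      (φ := fun τ' => c + 2 - Nat.log (n + 2) (τ'.reg 3).toNat) ?_ fun τ' hI hF' => ?_)
      ?_ ?_) ?_ fun _ h _ => h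
  · simp [Cmd.wp, hB1]
  · obtain ⟨h2, h1, h1', hM, h1a⟩ := hτ
    subst hρ
    simp only [State.reg_setReg, if_true, State.arr_setReg]
    refine ⟨one_pos, ?_, (List.range n).map (fun k : ℕ => (k : ℤ)), ⟨?_, fun x => ?_, ?_⟩, ?_, ?_⟩
    · simp; positivity
    · exact List.nodup_range.map Nat.cast_injective
    · simp only [List.mem_map, List.mem_range]
      exact ⟨fun ⟨k, hk, he⟩ => by omega, fun h => ⟨x.toNat, by omega, by omega⟩⟩
    · simp
    · intro k hk
      simp at hk ⊢
      exact h1a k (by omega) (by omega)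
    · rw [List.pairwise_map]
      refine List.Pairwise.imp (R := (· < ·)) ?_ List.pairwise_lt_range
      intro x y hxy
      right
      simpa using hxy
  · obtain ⟨h2, h1, h1', hM, h1a⟩ := hτ
    subst hρ
    obtain ⟨hw, hwB, l, he, hl, hs⟩ := hI
    have e0 : τ'.reg 0 = n := by rw [hF'.1 0 (by decide)]; simpa [h0] using hF.1 0 (by decide)
    have ef : τ'.arr 0 = f := by rw [hF'.2 0 (by decide)]; simpa [hf] using hF.2 0 (by decide)
    have e1 : τ'.reg 1 = τ.reg 1 := by rw [hF'.1 1 (by decide)]; simp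
    have e2 : τ'.reg 2 = n + 2 := by rw [hF'.1 2 (by decide)]; simpa using h2
    refine ⟨?_, fun hlt => ?_⟩
    · simp [hB1, e1, abs_le]
      omega
    simp [e1] at hlt
    refine Within.mono (Within.seq (T' := 4) (within_radixRound (b := n + 2) (by omega) (by omega) hw
      (by omega) (by omega) (by omega) e0 e1 (by rw [e2]; simp) rfl ef
      (fun x hx => hM x ((he.2.1 x).1 hx).1 ((he.2.1 x).1 hx).2) hl he hs) fun ρ hρ hF'' =>
      Within.of_wp (c := 3 :=: rg 3 * rg 2)
        (Q := fun ρ => (0 < ρ.reg 3 ∧ ρ.reg 3 ≤ 2 * τ.reg 1 * (n + 2) + 1 ∧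
        ∃ l, IsEnum n l ∧ Lists (ρ.arr 1) l ∧
          l.Pairwise (KeyLt (fun x => f x + τ.reg 1) (ρ.reg 3))) ∧
          c + 2 - Nat.log (n + 2) (ρ.reg 3).toNat < c + 2 - Nat.log (n + 2) (τ'.reg 3).toNat) ?_)
        ?_ fun _ h _ => h
    · have g3 := hF''.1 3 (by decide)
      have g2 := hF''.1 2 (by decide)
      have hle : τ'.reg 3 * (n + 2) ≤ 2 * τ.reg 1 * (n + 2) :=
        mul_le_mul_of_nonneg_right (by omega) (by omega)
      have hle' : 2 * τ.reg 1 * (n + 2) ≤ 2 * (((n : ℤ) + 2) ^ c * (n + 2)) := by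
        rw [mul_assoc]
        exact mul_le_mul_of_nonneg_left (mul_le_mul_of_nonneg_right h1' (by omega)) (by omega)
      have hpos : 0 < τ'.reg 3 * (n + 2) := by positivity
      have hs' := KeyLt.of_radixPass (b := n + 2) hw hs
      push_cast at hs'
      simp only [Cmd.wp, Expr.ok_mul, Expr.ok_reg, Expr.val_mul, Expr.val_reg, g2, g3, e2,
        State.reg_setReg, if_true, State.arr_setReg, true_and]
      refine ⟨abs_le.2 ⟨by omega, by omega⟩, ⟨hpos, by omega, _,
        he.radixPass (b := n + 2) hw (by omega) hs, hρ, hs'⟩, ?_⟩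
      have hlog : Nat.log (n + 2) (τ'.reg 3 * (n + 2)).toNat =
          Nat.log (n + 2) (τ'.reg 3).toNat + 1 := by
        rw [← Nat.log_mul_base (by omega) (by omega)]
        congr 1
        zify
        rw [Int.toNat_of_nonneg hpos.le, Int.toNat_of_nonneg hw.le]
      have hlog' : Nat.log (n + 2) (τ'.reg 3).toNat ≤ c + 1 := by
        refine (Nat.log_mono_right (m := (n + 2) ^ (c + 1)) ?_).trans
          (Nat.log_pow (by omega) _).le
        zify
        rw [Int.toNat_of_nonneg hw.le]
        omega
      omega
    · simp
      omega
  · have hcost : ((rg 3).lt (rg 1 + rg 1 + cst 1)).cost + 1 ≤ 10 := by decide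
    exact Nat.mul_le_mul (by omega) (by omega)
  · obtain ⟨h2, h1, h1', hM, h1a⟩ := hτ
    subst hρ
    rintro ρ ⟨⟨hw, hwB, l, he, hl, hs⟩, hv⟩ hF'
    have e1 : ρ.reg 1 = τ.reg 1 := by rw [hF'.1 1 (by decide)]; simp
    simp [e1] at hv
    refine ⟨l, he, hl, hs.imp_of_mem fun {x y} hx hy hxy => ?_⟩
    have hx' := abs_le.1 (hM x ((he.2.1 x).1 hx).1 ((he.2.1 x).1 hx).2)
    have hy' := abs_le.1 (hM y ((he.2.1 y).1 hy).1 ((he.2.1 y).1 hy).2)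
    rw [KeyLt, Int.emod_eq_of_lt (by omega) (by omega), Int.emod_eq_of_lt (by omega) (by omega)]
      at hxy
    omega
  · have hcost : (3 :=: cst 1).cost ≤ 2 := by decide
    rw [Int.toNat_natCast]
    have : (c + 4) * (400 * (n + 2)) = (c + 3) * (360 * (n + 2)) + (c + 3) * (40 * (n + 2)) +
      400 * (n + 2) := by ring
    omega

/-! ### Neighbours in the order of the letters -/

/-- The order of positions by their letters, ties being broken by the positions themselves. -/
def LexLt (f : ℤ → ℤ) (x y : ℤ) : Prop := f x < f y ∨ f x = f y ∧ x < y

/-- `v` is the predecessor of `x` among the positions below `m`, or `-1` if there is none. -/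
def IsPrev (f : ℤ → ℤ) (m x v : ℤ) : Prop :=
  (v = -1 ∧ ∀ y, 0 ≤ y → y < m → ¬ LexLt f y x) ∨
    (0 ≤ v ∧ v < m ∧ LexLt f v x ∧ ∀ y, 0 ≤ y → y < m → LexLt f y x → ¬ LexLt f v y)

/-- `v` is the successor of `x` among the positions below `m`, or `-1` if there is none. -/
def IsNext (f : ℤ → ℤ) (m x v : ℤ) : Prop :=
  (v = -1 ∧ ∀ y, 0 ≤ y → y < m → ¬ LexLt f x y) ∨
    (0 ≤ v ∧ v < m ∧ LexLt f x v ∧ ∀ y, 0 ≤ y → y < m → LexLt f x y → ¬ LexLt f y v)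

theorem LexLt.irrefl {f : ℤ → ℤ} (x : ℤ) : ¬ LexLt f x x := by unfold LexLt; omega

theorem LexLt.trans {f : ℤ → ℤ} {x y z : ℤ} (h : LexLt f x y) (h' : LexLt f y z) :
    LexLt f x z := by unfold LexLt at *; omega

theorem LexLt.total {f : ℤ → ℤ} {x y : ℤ} (h : x ≠ y) : LexLt f x y ∨ LexLt f y x := by
  unfold LexLt; omega

/-- Deletion of the position `i` from a doubly linked list of the positions `0, …, i`
has the expected effect on the predecessors. -/
theorem IsPrev.delete {f : ℤ → ℤ} {i p q x v : ℤ} (hv : IsPrev f (i + 1) x v)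
    (hi : 0 ≤ i) (hp : IsPrev f (i + 1) i p)
    (hq : IsNext f (i + 1) i q) (hx : 0 ≤ x) (hxi : x < i) :
    IsPrev f i x (if x = q then p else v) := by
  split_ifs with hxq
  · subst hxq
    rcases hq with ⟨h, -⟩ | ⟨-, -, hq1, hq2⟩
    · omega
    rcases hp with ⟨h, hp⟩ | ⟨hp0, hp1, hp2, hp3⟩
    · refine Or.inl ⟨h, fun y hy hyi hyx => ?_⟩
      rcases LexLt.total (f := f) hyi.ne with h1 | h1
      · exact hp y hy (by omega) h1
      · exact hq2 y hy (by omega) h1 hyx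
    · have hpi : p ≠ i := fun h => LexLt.irrefl (f := f) i (by rwa [h] at hp2)
      refine Or.inr ⟨hp0, by omega, hp2.trans hq1, fun y hy hyi hyx hpy => ?_⟩
      rcases LexLt.total (f := f) hyi.ne with h1 | h1
      · exact hp3 y hy (by omega) h1 hpy
      · exact hq2 y hy (by omega) h1 hyx
  · rcases hv with ⟨h, hv⟩ | ⟨hv0, hv1, hv2, hv3⟩
    · exact Or.inl ⟨h, fun y hy hyi => hv y hy (by omega)⟩
    · refine Or.inr ⟨hv0, ?_, hv2, fun y hy hyi => hv3 y hy (by omega)⟩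
      by_contra hvi
      obtain rfl : v = i := by omega
      rcases hq with ⟨h, hq⟩ | ⟨hq0, hq', hq1, hq2⟩
      · exact hq x hx (by omega) hv2
      · rcases LexLt.total (f := f) hxq with h1 | h1
        · exact hq2 x hx (by omega) hv2 h1
        · exact hv3 q hq0 hq' h1 hq1

/-- Deletion of the position `i` from a doubly linked list of the positions `0, …, i`
has the expected effect on the successors. -/
theorem IsNext.delete {f : ℤ → ℤ} {i p q x v : ℤ} (hv : IsNext f (i + 1) x v)
    (hi : 0 ≤ i) (hp : IsPrev f (i + 1) i p)
    (hq : IsNext f (i + 1) i q) (hx : 0 ≤ x) (hxi : x < i) :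
    IsNext f i x (if x = p then q else v) := by
  split_ifs with hxp
  · subst hxp
    rcases hp with ⟨h, -⟩ | ⟨-, -, hp1, hp2⟩
    · omega
    rcases hq with ⟨h, hq⟩ | ⟨hq0, hq1, hq2, hq3⟩
    · refine Or.inl ⟨h, fun y hy hyi hyx => ?_⟩
      rcases LexLt.total (f := f) hyi.ne with h1 | h1
      · exact hp2 y hy (by omega) h1 hyx
      · exact hq y hy (by omega) h1
    · have hqi : q ≠ i := fun h => LexLt.irrefl (f := f) i (by rwa [h] at hq2)
      refine Or.inr ⟨hq0, by omega, hp1.trans hq2, fun y hy hyi hyx hyq => ?_⟩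
      rcases LexLt.total (f := f) hyi.ne with h1 | h1
      · exact hp2 y hy (by omega) h1 hyx
      · exact hq3 y hy (by omega) h1 hyq
  · rcases hv with ⟨h, hv⟩ | ⟨hv0, hv1, hv2, hv3⟩
    · exact Or.inl ⟨h, fun y hy hyi => hv y hy (by omega)⟩
    · refine Or.inr ⟨hv0, ?_, hv2, fun y hy hyi => hv3 y hy (by omega)⟩
      by_contra hvi
      obtain rfl : v = i := by omega
      rcases hp with ⟨h, hp⟩ | ⟨hp0, hp', hp1, hp2⟩
      · exact hp x hx (by omega) hv2
      · rcases LexLt.total (f := f) hxp with h1 | h1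
        · exact hv3 p hp0 hp' h1 hp1
        · exact hp2 x hx (by omega) hv2 h1

theorem IsPrev.shrink {f : ℤ → ℤ} {i p : ℤ} (hp : IsPrev f (i + 1) i p) : IsPrev f i i p := by
  rcases hp with ⟨h, hp⟩ | ⟨hp0, hp1, hp2, hp3⟩
  · exact Or.inl ⟨h, fun y hy hyi => hp y hy (by omega)⟩
  · have hpi : p ≠ i := fun h => LexLt.irrefl (f := f) i (by rwa [h] at hp2)
    exact Or.inr ⟨hp0, by omega, hp2, fun y hy hyi => hp3 y hy (by omega)⟩

theorem IsNext.shrink {f : ℤ → ℤ} {i p : ℤ} (hp : IsNext f (i + 1) i p) : IsNext f i i p := by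
  rcases hp with ⟨h, hp⟩ | ⟨hp0, hp1, hp2, hp3⟩
  · exact Or.inl ⟨h, fun y hy hyi => hp y hy (by omega)⟩
  · have hpi : p ≠ i := fun h => LexLt.irrefl (f := f) i (by rwa [h] at hp2)
    exact Or.inr ⟨hp0, by omega, hp2, fun y hy hyi => hp3 y hy (by omega)⟩

/-- The sorted list of the positions in array `1` is turned into a doubly linked list: arrays `4` and
`5` hold the predecessors and the successors, with `-1` for the ends. The cells `-1` and `n` of array
`1` serve as sentinels. -/
def link : Cmd :=
  (Cmd.write 1 (cst (-1)) (cst (-1)) ;; Cmd.write 1 (rg 0) (cst (-1)) ;; 6 :=: cst 0) ;;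
  .loop ((rg 6).lt (rg 0))
    (4 :=: rd 1 (rg 6) ;; Cmd.write 4 (rg 4) (rd 1 (rg 6 - cst 1)) ;;
     6 :=: rg 6 + cst 1 ;; Cmd.write 5 (rg 4) (rd 1 (rg 6)))

theorem within_link {B : ℕ} {σ : State} {n : ℤ} {f : ℤ → ℤ} {l : List ℤ} (hn : 0 ≤ n)
    (hB : n + 2 ≤ B) (h0 : σ.reg 0 = n) (he : IsEnum n l) (hl : Lists (σ.arr 1) l)
    (hs : l.Pairwise (LexLt f)) :
    Within B link σ (50 * (n.toNat + 2)) fun τ => ∀ x, 0 ≤ x → x < n →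
      IsPrev f n x (τ.arr 4 x) ∧ IsNext f n x (τ.arr 5 x) := by
  have hB1 : 1 ≤ B := by omega
  have hln := he.2.2
  refine (Within.seq_loop 50
    (I := fun τ => (0 ≤ τ.reg 6 ∧ τ.reg 6 ≤ n) ∧ τ.arr 1 (-1) = -1 ∧ τ.arr 1 n = -1 ∧
      Lists (τ.arr 1) l ∧ ∀ (j : ℕ) (hj : j < l.length), (j : ℤ) < τ.reg 6 →
        τ.arr 4 l[j] = τ.arr 1 (j - 1) ∧ τ.arr 5 l[j] = τ.arr 1 (j + 1))
    (φ := fun τ => (n - τ.reg 6).toNat) (N := n.toNat) (by decide) (by decide)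
    ?_ fun τ hI hF => ?_).mono le_rfl ?_
  · simp [Cmd.wp, hB1, h0]
    refine ⟨hn, ?_, ?_⟩
    · rw [Function.update_of_ne (by omega), Function.update_self]
    · intro k hk
      rw [Function.update_of_ne (by omega), Function.update_of_ne (by omega), hl k hk]
  · have e0 : τ.reg 0 = n := by rw [hF.1 0 (by decide), h0]
    obtain ⟨⟨r0, rn⟩, a1, an, al, hj⟩ := hI
    refine ⟨by simp [hB1], fun hlt => ?_⟩
    simp [e0] at hlt
    have hk : (τ.reg 6).toNat < l.length := by omega
    have e1 : τ.arr 1 (τ.reg 6) = l[(τ.reg 6).toNat] := by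
      have := al _ hk
      rwa [Int.toNat_of_nonneg r0] at this
    simp [Cmd.wp, hB1, abs_le, e1]
    refine ⟨by omega, by omega, ⟨⟨by omega, by omega⟩, a1, an, al, fun j hj' hjk => ?_⟩, by omega⟩
    by_cases hjk' : j = (τ.reg 6).toNat
    · subst hjk'
      simp [Int.toNat_of_nonneg r0]
    · have hne : l[j] ≠ l[(τ.reg 6).toNat] := fun h => hjk' ((he.1.getElem_inj_iff).1 h)
      rw [Function.update_of_ne hne, Function.update_of_ne hne]
      exact hj j hj' (by omega)
  · rintro τ ⟨⟨⟨r0, rn⟩, a1, an, al, hj⟩, hv⟩ hF x hx hxn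
    have e0 : τ.reg 0 = n := by rw [hF.1 0 (by decide), h0]
    simp [e0] at hv
    obtain ⟨j, hjl, rfl⟩ := List.getElem_of_mem ((he.2.1 x).2 ⟨hx, hxn⟩)
    obtain ⟨h4, h5⟩ := hj j hjl (by omega)
    rw [h4, h5]
    have hmono : ∀ i k (hi : i < l.length) (hk : k < l.length), LexLt f l[i] l[k] ↔ i < k := by
      intro i k hi hk
      have hs' := List.pairwise_iff_getElem.1 hs
      refine ⟨fun h => ?_, fun h => hs' i k hi hk h⟩
      by_contra hcon
      rcases (not_lt.1 hcon).eq_or_lt with rfl | h'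
      · exact LexLt.irrefl _ h
      · exact LexLt.irrefl _ (h.trans (hs' k i hk hi h'))
    have hmem : ∀ y, 0 ≤ y → y < n → ∃ i, ∃ hi : i < l.length, l[i] = y := fun y h0 h1 =>
      List.getElem_of_mem ((he.2.1 y).2 ⟨h0, h1⟩)
    have hrange : ∀ i (hi : i < l.length), 0 ≤ l[i] ∧ l[i] < n := fun i hi =>
      (he.2.1 _).1 (List.getElem_mem hi)
    constructor
    · rcases j with _ | j
      · refine Or.inl ⟨by simpa using a1, fun y hy hyn => ?_⟩
        obtain ⟨i, hi, rfl⟩ := hmem y hy hyn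
        rw [hmono]; omega
      · have := al j (by omega)
        rw [show ((j + 1 : ℕ) : ℤ) - 1 = j by push_cast; ring, this]
        refine Or.inr ⟨(hrange j _).1, (hrange j _).2, (hmono _ _ _ _).2 (by omega),
          fun y hy hyn => ?_⟩
        obtain ⟨i, hi, rfl⟩ := hmem y hy hyn
        rw [hmono, hmono]; omega
    · by_cases hjn : j + 1 < l.length
      · have := al (j + 1) hjn
        push_cast at this
        rw [this]
        refine Or.inr ⟨(hrange _ _).1, (hrange _ _).2, (hmono _ _ _ _).2 (by omega),
          fun y hy hyn => ?_⟩
        obtain ⟨i, hi, rfl⟩ := hmem y hy hyn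
        rw [hmono, hmono]; omega
      · refine Or.inl ⟨by rw [show (j : ℤ) + 1 = n by omega]; exact an, fun y hy hyn => ?_⟩
        obtain ⟨i, hi, rfl⟩ := hmem y hy hyn
        rw [hmono]; omega

/-- The positions `n - 1, n - 2, …, 0` are deleted, in this order, from the doubly linked list. The
entries for a position do not change any more after its deletion, hence finally describe its neighbours
among the smaller positions. If a neighbour is missing, the update goes to the unused cell `-1`. -/
def unlink : Cmd :=
  4 :=: rg 0 ;; .loop ((cst 0).lt (rg 4))
    (4 :=: rg 4 - cst 1 ;; 8 :=: rd 4 (rg 4) ;; 9 :=: rd 5 (rg 4) ;;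
     Cmd.write 5 (rg 8) (rg 9) ;; Cmd.write 4 (rg 9) (rg 8))

theorem within_unlink {B : ℕ} {σ : State} {n : ℤ} {f : ℤ → ℤ} (hn : 0 ≤ n)
    (hB : n + 2 ≤ B) (h0 : σ.reg 0 = n) (hl : ∀ x, 0 ≤ x → x < n →
      IsPrev f n x (σ.arr 4 x) ∧ IsNext f n x (σ.arr 5 x)) :
    Within B unlink σ (50 * (n.toNat + 2)) fun τ => ∀ x, 0 ≤ x → x < n →
      IsPrev f x x (τ.arr 4 x) ∧ IsNext f x x (τ.arr 5 x) := by
  have hB1 : 1 ≤ B := by omega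
  refine (Within.seq_loop 50
    (I := fun τ => (0 ≤ τ.reg 4 ∧ τ.reg 4 ≤ n) ∧
      (∀ x, 0 ≤ x → x < τ.reg 4 → IsPrev f (τ.reg 4) x (τ.arr 4 x) ∧
        IsNext f (τ.reg 4) x (τ.arr 5 x)) ∧
      ∀ x, τ.reg 4 ≤ x → x < n → IsPrev f x x (τ.arr 4 x) ∧ IsNext f x x (τ.arr 5 x))
    (φ := fun τ => (τ.reg 4).toNat) (N := n.toNat) (by decide) (by decide)
    ?_ fun τ hI hF => ?_).mono le_rfl ?_
  · simp [Cmd.wp, h0]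
    exact ⟨hn, hl, by intros; omega⟩
  · obtain ⟨⟨r0, rn⟩, h1, h2⟩ := hI
    refine ⟨by simp [hB1], fun hlt => ?_⟩
    simp at hlt
    obtain ⟨i, hi⟩ : ∃ i, τ.reg 4 = i + 1 := ⟨τ.reg 4 - 1, by omega⟩
    rw [hi] at r0 rn h1 h2
    have hi0 : 0 ≤ i := by omega
    obtain ⟨hp, hq⟩ := h1 i hi0 (by omega)
    simp [Cmd.wp, abs_le, hi]
    refine ⟨by omega, ⟨⟨hi0, by omega⟩, fun x hx hxi => ?_, fun x hx hxn => ?_⟩, by omega⟩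
    · obtain ⟨hp', hq'⟩ := h1 x hx (by omega)
      simp only [Function.update_apply]
      exact ⟨hp'.delete hi0 hp hq hx hxi, hq'.delete hi0 hp hq hx hxi⟩
    · have hqi : τ.arr 5 i ≠ x := by
        rcases hq.shrink with h | h <;> omega
      have hpi : τ.arr 4 i ≠ x := by
        rcases hp.shrink with h | h <;> omega
      rw [Function.update_of_ne hqi.symm, Function.update_of_ne hpi.symm]
      rcases hx.eq_or_lt with rfl | hx
      · exact ⟨hp.shrink, hq.shrink⟩
      · exact h2 x (by omega) hxn
  · rintro τ ⟨⟨⟨r0, rn⟩, h1, h2⟩, hv⟩ hF x hx hxn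
    simp at hv
    exact h2 x (by omega) hxn

/-! ### The lengths of the longest order-equivalent prefixes -/

/-- The substring of length `k` at the position `i` is order-equivalent to the prefix of
length `k`. -/
def Match (f : ℤ → ℤ) (i k : ℤ) : Prop :=
  ∀ x y, 0 ≤ x → x < k → 0 ≤ y → y < k → (f x < f y ↔ f (i + x) < f (i + y))

theorem Match.mono {f : ℤ → ℤ} {i k k' : ℤ} (h : Match f i k) (hk : k' ≤ k) : Match f i k' :=
  fun x y hx hxk hy hyk => h x y hx (by omega) hy (by omega)

/-- Whether a match can be extended by one letter depends only on how this letter compares to the two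
letters that are closest to it. -/
theorem Match.succ_iff {f : ℤ → ℤ} {i k a b : ℤ} (h : Match f i k) (hk : 0 ≤ k)
    (ha : IsPrev f k k a) (hb : IsNext f k k b) :
    Match f i (k + 1) ↔ (a < 0 ∨ SameCmp f a k (i + a) (i + k)) ∧
      (b < 0 ∨ SameCmp f b k (i + b) (i + k)) := by
  constructor
  · intro h'
    have key : ∀ c, 0 ≤ c → c < k → SameCmp f c k (i + c) (i + k) := fun c h0 hc =>
      ⟨h' c k h0 (by omega) hk (by omega), h' k c hk (by omega) h0 (by omega)⟩
    constructor
    · by_cases h0 : a < 0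
      · exact Or.inl h0
      · exact Or.inr (key a (by omega) (by rcases ha with h | h <;> omega))
    · by_cases h0 : b < 0
      · exact Or.inl h0
      · exact Or.inr (key b (by omega) (by rcases hb with h | h <;> omega))
  · rintro ⟨hka, hkb⟩
    have key : ∀ j, 0 ≤ j → j < k → SameCmp f j k (i + j) (i + k) := by
      intro j hj hjk
      rcases LexLt.total (f := f) hjk.ne with h1 | h1
      · rcases ha with ⟨-, ha⟩ | ⟨ha0, hak, ha, ha'⟩
        · exact absurd h1 (ha j hj hjk)
        · have e1 := h j a hj hjk ha0 hak
          have e2 := h a j ha0 hak hj hjk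
          have e3 := ha' j hj hjk h1
          have e4 := hka.resolve_left (by omega)
          unfold LexLt SameCmp at *
          omega
      · rcases hb with ⟨-, hb⟩ | ⟨hb0, hbk, hb, hb'⟩
        · exact absurd h1 (hb j hj hjk)
        · have e1 := h j b hj hjk hb0 hbk
          have e2 := h b j hb0 hbk hj hjk
          have e3 := hb' j hj hjk h1
          have e4 := hkb.resolve_left (by omega)
          unfold LexLt SameCmp at *
          omega
    intro x y hx hxk hy hyk
    by_cases hxk' : x = k
    · by_cases hyk' : y = k
      · simp [hxk', hyk']
      · rw [hxk']; exact (key y hy (by omega)).2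
    · by_cases hyk' : y = k
      · rw [hyk']; exact (key x hx (by omega)).1
      · exact h x y hx (by omega) hy (by omega)

/-- `v` is the length of the longest substring at the position `i` that is order-equivalent to a
prefix. -/
def IsZ (f : ℤ → ℤ) (n i v : ℤ) : Prop :=
  0 ≤ v ∧ i + v ≤ n ∧ Match f i v ∧ (i + v < n → ¬ Match f i (v + 1))

/-- The test whether the letter at `a` compares to the one at `b` as the letter at `c` does to the one
at `d`. -/
def sameCmp (a b c d : Expr) : Expr :=
  ((rd 0 a).lt (rd 0 b)).eq ((rd 0 c).lt (rd 0 d)) *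
    ((rd 0 b).lt (rd 0 a)).eq ((rd 0 d).lt (rd 0 c))

instance (f : ℤ → ℤ) (a b c d : ℤ) : Decidable (SameCmp f a b c d) :=
  inferInstanceAs (Decidable (_ ∧ _))

theorem val_sameCmp (σ : State) (a b c d : Expr) : (sameCmp a b c d).val σ =
    if SameCmp (σ.arr 0) (a.val σ) (b.val σ) (c.val σ) (d.val σ) then 1 else 0 := by
  by_cases h1 : σ.arr 0 (a.val σ) < σ.arr 0 (b.val σ) <;>
  by_cases h2 : σ.arr 0 (b.val σ) < σ.arr 0 (a.val σ) <;>
  by_cases h3 : σ.arr 0 (c.val σ) < σ.arr 0 (d.val σ) <;>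
  by_cases h4 : σ.arr 0 (d.val σ) < σ.arr 0 (c.val σ) <;>
  simp [sameCmp, SameCmp, h1, h2, h3, h4]

theorem ok_sameCmp {B : ℕ} {σ : State} {a b c d : Expr} (hB : 1 ≤ B) (ha : a.Ok B σ)
    (hb : b.Ok B σ) (hc : c.Ok B σ) (hd : d.Ok B σ) : (sameCmp a b c d).Ok B σ := by
  refine ⟨?_, ?_, ?_⟩
  · simp [hB, ha, hb, hc, hd]
  · simp [hB, ha, hb, hc, hd]
  · have := val_sameCmp σ a b c d
    change |(sameCmp a b c d).val σ| ≤ _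
    rw [this]
    exact abs_ite_le hB _

/-- The test whether a match of length `k` (register `6`) at the position `i` (register `4`) extends
by one letter. Registers `8` and `9` hold the neighbours of `k`. -/
def matchTest : Expr :=
  (rg 4 + rg 6).lt (rg 0) *
    (((rg 8).lt (cst 0) + sameCmp (rg 8) (rg 6) (rg 4 + rg 8) (rg 4 + rg 6)) *
      ((rg 9).lt (cst 0) + sameCmp (rg 9) (rg 6) (rg 4 + rg 9) (rg 4 + rg 6)))

theorem val_matchTest_eq_zero (σ : State) : matchTest.val σ = 0 ↔
    ¬ (σ.reg 4 + σ.reg 6 < σ.reg 0 ∧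
      (σ.reg 8 < 0 ∨
        SameCmp (σ.arr 0) (σ.reg 8) (σ.reg 6) (σ.reg 4 + σ.reg 8) (σ.reg 4 + σ.reg 6)) ∧
      (σ.reg 9 < 0 ∨
        SameCmp (σ.arr 0) (σ.reg 9) (σ.reg 6) (σ.reg 4 + σ.reg 9) (σ.reg 4 + σ.reg 6))) := by
  simp only [matchTest, Expr.val_mul, Expr.val_add, val_sameCmp, Expr.val_lt, Expr.val_reg,
    Expr.val_const]
  by_cases h1 : σ.reg 4 + σ.reg 6 < σ.reg 0 <;>
  by_cases h2 : σ.reg 8 < 0 <;>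
  by_cases h3 : SameCmp (σ.arr 0) (σ.reg 8) (σ.reg 6) (σ.reg 4 + σ.reg 8) (σ.reg 4 + σ.reg 6) <;>
  by_cases h4 : σ.reg 9 < 0 <;>
  by_cases h5 : SameCmp (σ.arr 0) (σ.reg 9) (σ.reg 6) (σ.reg 4 + σ.reg 9) (σ.reg 4 + σ.reg 6) <;>
  simp [h1, h2, h3, h4, h5]

theorem ok_matchTest {B : ℕ} {σ : State} {n : ℤ} (hB : 2 * n + 4 ≤ B) (h4 : 0 ≤ σ.reg 4)
    (h4' : σ.reg 4 ≤ n) (h6 : 0 ≤ σ.reg 6) (h6' : σ.reg 6 ≤ n) (h8 : -1 ≤ σ.reg 8)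
    (h8' : σ.reg 8 ≤ n) (h9 : -1 ≤ σ.reg 9) (h9' : σ.reg 9 ≤ n) : matchTest.Ok B σ := by
  have hB1 : 1 ≤ B := by omega
  have a1 : |σ.reg 4 + σ.reg 6| ≤ (B : ℤ) := abs_le.2 ⟨by omega, by omega⟩
  have a2 : |σ.reg 4 + σ.reg 8| ≤ (B : ℤ) := abs_le.2 ⟨by omega, by omega⟩
  have a3 : |σ.reg 4 + σ.reg 9| ≤ (B : ℤ) := abs_le.2 ⟨by omega, by omega⟩
  have s1 : (sameCmp (rg 8) (rg 6) (rg 4 + rg 8) (rg 4 + rg 6)).Ok B σ :=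
    ok_sameCmp hB1 (by simp) (by simp) (by simpa using a2) (by simpa using a1)
  have s2 : (sameCmp (rg 9) (rg 6) (rg 4 + rg 9) (rg 4 + rg 6)).Ok B σ :=
    ok_sameCmp hB1 (by simp) (by simp) (by simpa using a3) (by simpa using a1)
  have hB2 : (4 : ℤ) ≤ B := by omega
  have t0 : ∀ p : Prop, [Decidable p] → 0 ≤ (if p then (1 : ℤ) else 0) ∧
      (if p then (1 : ℤ) else 0) ≤ 1 := fun p _ => by split_ifs <;> simp
  have key : ∀ u v w x y : ℤ, (0 ≤ u ∧ u ≤ 1) → (0 ≤ v ∧ v ≤ 1) → (0 ≤ w ∧ w ≤ 1) →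
      (0 ≤ x ∧ x ≤ 1) → (0 ≤ y ∧ y ≤ 1) → |u + v| ≤ (B : ℤ) ∧ |w + x| ≤ (B : ℤ) ∧
      |(u + v) * (w + x)| ≤ (B : ℤ) ∧ |y * ((u + v) * (w + x))| ≤ (B : ℤ) := by
    intro u v w x y hu hv hw hx hy
    have h1 : 0 ≤ (u + v) * (w + x) := mul_nonneg (by omega) (by omega)
    have h2 : (u + v) * (w + x) ≤ 2 * 2 :=
      mul_le_mul (by omega) (by omega) (by omega) (by omega)
    have h3 : 0 ≤ y * ((u + v) * (w + x)) := mul_nonneg hy.1 h1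
    have h4 : y * ((u + v) * (w + x)) ≤ 1 * (2 * 2) := mul_le_mul hy.2 h2 h1 (by omega)
    rw [abs_of_nonneg h3, abs_of_nonneg h1, abs_of_nonneg (by omega), abs_of_nonneg (by omega)]
    omega
  have hlt : ∀ e e' : Expr, 0 ≤ (e.lt e').val σ ∧ (e.lt e').val σ ≤ 1 := fun e e' => t0 _
  have hsame : ∀ a b c d : Expr, 0 ≤ (sameCmp a b c d).val σ ∧ (sameCmp a b c d).val σ ≤ 1 :=
    fun a b c d => by rw [val_sameCmp]; exact t0 _
  obtain ⟨k1, k2, k3, k4⟩ := key _ _ _ _ _ (hlt (rg 8) (cst 0))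
    (hsame (rg 8) (rg 6) (rg 4 + rg 8) (rg 4 + rg 6)) (hlt (rg 9) (cst 0))
    (hsame (rg 9) (rg 6) (rg 4 + rg 9) (rg 4 + rg 6)) (hlt (rg 4 + rg 6) (rg 0))
  exact ⟨by simpa [hB1] using a1, ⟨⟨by simp [hB1], s1, k1⟩, ⟨by simp [hB1], s2, k2⟩, k3⟩, k4⟩

/-- The algorithm that computes the array `6` of the lengths of the longest order-equivalent prefixes.
At the position `i` (register `4`) a match of length `k` (register `6`) has been established. The
interval from `l` to `r` (registers `10` and `11`) is the match found so far that extends furthest. -/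
def prefixArray : Cmd :=
  (4 :=: cst 1 ;; 6 :=: cst 0 ;; 10 :=: cst 0 ;; 11 :=: cst 0) ;;
  .loop ((rg 4).lt (rg 0))
    (8 :=: rd 4 (rg 6) ;; 9 :=: rd 5 (rg 6) ;;
     .ite matchTest
      (6 :=: rg 6 + cst 1)
      (Cmd.write 6 (rg 4) (rg 6) ;;
       Cmd.ite ((rg 4 + rg 6).lt (rg 11)) .skip (10 :=: rg 4 ;; 11 :=: rg 4 + rg 6) ;;
       4 :=: rg 4 + cst 1 ;;
       .ite ((rg 4).lt (rg 11))
        (6 :=: rd 6 (rg 4 - rg 10) ;;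
         .ite ((rg 11 - rg 4).lt (rg 6)) (6 :=: rg 11 - rg 4) .skip)
        (6 :=: cst 0)))

/-- The invariant of `prefixArray`: `i`, `k`, `l`, `r` are the registers described there, and `z` is the
array `6`. A match that ends before `r` is already maximal (`furthest`). -/
structure ZInv (f : ℤ → ℤ) (n i k l r : ℤ) (z : ℤ → ℤ) : Prop where
  one_le : 1 ≤ i
  le_n : i ≤ n
  nonneg : 0 ≤ k
  add_le : i + k ≤ n
  r_le : r ≤ n
  box : i < r → 1 ≤ l ∧ l < i ∧ Match f l (r - l)
  cur : Match f i k
  furthest : r ≤ i + k ∨ i + k < n ∧ ¬ Match f i (k + 1)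
  done : ∀ j, 1 ≤ j → j < i → IsZ f n j (z j)

/-- A match that can be extended reaches the end of the box. -/
theorem ZInv.extend {f : ℤ → ℤ} {n i k l r : ℤ} {z : ℤ → ℤ} (h : ZInv f n i k l r z)
    (hn : i + k < n) (hm : Match f i (k + 1)) : r ≤ i + k ∧ ZInv f n i (k + 1) l r z := by
  have hr : r ≤ i + k := h.furthest.resolve_right fun h' => h'.2 hm
  have := h.nonneg
  exact ⟨hr, h.one_le, h.le_n, by omega, by omega, h.r_le, h.box, hm, Or.inl (by omega), h.done⟩

/-- The start value of the match at the next position: a copy of an earlier entry, cut off at the end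
of the box. -/
theorem ZInv.next {f : ℤ → ℤ} {n i k l r l' r' k' : ℤ} {z z' : ℤ → ℤ} (h : ZInv f n i k l r z)
    (hin : i < n) (hm : ¬ (i + k < n ∧ Match f i (k + 1)))
    (hlr : i + k < r ∧ l' = l ∧ r' = r ∨ r ≤ i + k ∧ l' = i ∧ r' = i + k)
    (hz : z' = Function.update z i k)
    (hk : i + 1 < r' ∧ k' = min (z' (i + 1 - l')) (r' - (i + 1)) ∨ r' ≤ i + 1 ∧ k' = 0) :
    ZInv f n (i + 1) k' l' r' z' := by
  obtain ⟨h1, h2, h3, h4, h5, h6, h7, h8, h9⟩ := h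
  have hmax : r' ≤ n := by omega
  have hdone : ∀ j, 1 ≤ j → j < i + 1 → IsZ f n j (z' j) := by
    intro j hj hji
    rw [hz]
    by_cases hji' : j = i
    · subst hji'
      rw [Function.update_self]
      exact ⟨h3, h4, h7, fun hlt hM => hm ⟨hlt, hM⟩⟩
    · rw [Function.update_of_ne hji']
      exact h9 j hj (by omega)
  have hbox : i + 1 < r' → 1 ≤ l' ∧ l' < i + 1 ∧ Match f l' (r' - l') := by
    intro hir
    rcases hlr with ⟨ha, rfl, rfl⟩ | ⟨ha, rfl, rfl⟩
    · obtain ⟨b1, b2, b3⟩ := h6 (by omega)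
      exact ⟨b1, by omega, b3⟩
    · refine ⟨h1, by omega, ?_⟩
      rwa [add_sub_cancel_left]
  rcases hk with ⟨hir, hk⟩ | ⟨hir, hk⟩
  · obtain ⟨b1, b2, b3⟩ := hbox hir
    obtain ⟨c1, c2, c3, c4⟩ := hdone (i + 1 - l') (by omega) (by omega)
    -- Within the box, matches at `i + 1` are the same as matches at `i + 1 - l'`.
    have htransfer : ∀ t, t ≤ r' - (i + 1) → (Match f (i + 1) t ↔ Match f (i + 1 - l') t) := by
      intro t ht
      have hshift : ∀ x y, 0 ≤ x → x < t → 0 ≤ y → y < t →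
          (f (i + 1 - l' + x) < f (i + 1 - l' + y) ↔ f (i + 1 + x) < f (i + 1 + y)) := by
        intro x y hx hxt hy hyt
        have := b3 (i + 1 - l' + x) (i + 1 - l' + y) (by omega) (by omega) (by omega) (by omega)
        rwa [show l' + (i + 1 - l' + x) = i + 1 + x by ring,
          show l' + (i + 1 - l' + y) = i + 1 + y by ring] at this
      exact ⟨fun hM x y hx hxt hy hyt =>
          (hM x y hx hxt hy hyt).trans (hshift x y hx hxt hy hyt).symm,
        fun hM x y hx hxt hy hyt => (hM x y hx hxt hy hyt).trans (hshift x y hx hxt hy hyt)⟩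
    have hk1 : k' ≤ z' (i + 1 - l') := hk ▸ min_le_left _ _
    have hk2 : k' ≤ r' - (i + 1) := hk ▸ min_le_right _ _
    refine ⟨by omega, by omega, by omega, by omega, hmax, hbox,
      (htransfer _ hk2).2 (c3.mono hk1), ?_, hdone⟩
    by_cases hlt : z' (i + 1 - l') < r' - (i + 1)
    · right
      have hkz : k' = z' (i + 1 - l') := by omega
      refine ⟨by omega, fun hM => c4 (by omega) ?_⟩
      rw [← hkz]
      exact (htransfer _ (by omega)).1 hM
    · left; omega
  · refine ⟨by omega, by omega, by omega, by omega, hmax, hbox, ?_, Or.inl (by omega), hdone⟩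
    intro x y hx hxk
    omega

theorem within_prefixArray {B : ℕ} {σ : State} {n : ℤ} {f : ℤ → ℤ} (hn : 1 ≤ n)
    (hB : 2 * n + 4 ≤ B) (h0 : σ.reg 0 = n) (hf : σ.arr 0 = f) (hl : ∀ x, 0 ≤ x → x < n →
      IsPrev f x x (σ.arr 4 x) ∧ IsNext f x x (σ.arr 5 x)) :
    Within B prefixArray σ (200 * (2 * n.toNat + 2)) fun τ => ∀ i, 1 ≤ i → i < n →
      IsZ f n i (τ.arr 6 i) := by
  have hB1 : 1 ≤ B := by omega
  refine (Within.seq_loop 200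
    (I := fun τ => ZInv f n (τ.reg 4) (τ.reg 6) (τ.reg 10) (τ.reg 11) (τ.arr 6))
    -- Each iteration increases `i`, or else the end of the match that extends furthest.
    (φ := fun τ => (n - τ.reg 4).toNat + (n - max (τ.reg 11) (τ.reg 4 + τ.reg 6)).toNat)
    (N := 2 * n.toNat) (by decide) (by decide)
    ?_ fun τ hI hF => ?_).mono le_rfl ?_
  · simp [Cmd.wp, hB1]
    refine ⟨⟨le_rfl, hn, le_rfl, by omega, by omega, by omega, fun x y hx hxk => by omega,
      Or.inl (by omega), fun j h1 h2 => by omega⟩, by omega⟩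
  · have e0 : τ.reg 0 = n := by rw [hF.1 0 (by decide), h0]
    have ef : τ.arr 0 = f := by rw [hF.2 0 (by decide), hf]
    have e4 : τ.arr 4 = σ.arr 4 := hF.2 4 (by decide)
    have e5 : τ.arr 5 = σ.arr 5 := hF.2 5 (by decide)
    refine ⟨by simp [hB1], fun hlt => ?_⟩
    simp [e0] at hlt
    have i1 := hI.one_le
    have i2 := hI.nonneg
    have i3 := hI.add_le
    have i4 := hI.r_le
    obtain ⟨hp, hq⟩ := hl (τ.reg 6) i2 (by omega)
    have hext := hI.cur.succ_iff i2 hp hq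
    have hp' : -1 ≤ σ.arr 4 (τ.reg 6) ∧ σ.arr 4 (τ.reg 6) ≤ n := by
      rcases hp with h | h <;> omega
    have hq' : -1 ≤ σ.arr 5 (τ.reg 6) ∧ σ.arr 5 (τ.reg 6) ≤ n := by
      rcases hq with h | h <;> omega
    simp only [Cmd.wp, Expr.ok_read, Expr.ok_reg, Expr.val_read, Expr.val_reg, true_and, e4, e5,
      State.arr_setReg]
    refine ⟨?_, fun hv => ?_, fun hv => ?_⟩
    · exact ok_matchTest (n := n) hB (by simp; omega) (by simp; omega) (by simp; omega)
        (by simp; omega) (by simp [hp']) (by simp [hp']) (by simp [hq']) (by simp [hq'])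
    · rw [ne_eq, val_matchTest_eq_zero, not_not] at hv
      simp [e0, ef] at hv
      rw [← hext] at hv
      obtain ⟨hr, hI'⟩ := hI.extend hv.1 hv.2
      simp [abs_le]
      exact ⟨by omega, hI', by omega⟩
    · rw [val_matchTest_eq_zero] at hv
      simp only [State.reg_setReg, State.arr_setReg, e0, ef] at hv
      simp only [Nat.reduceEqDiff, if_false, if_true] at hv
      rw [← hext] at hv
      have key := fun l' r' k' h1 h2 => hI.next (l' := l') (r' := r') (k' := k') hlt hv h1 rfl h2
      simp [hB1, abs_le]
      have e1 : τ.reg 4 + 1 - τ.reg 4 = 1 := by ring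
      refine ⟨by omega, fun hr => ⟨by omega, fun hb => ?_, fun hb => ?_⟩,
        fun hr => ⟨by omega, by omega, fun hb => ?_, fun hb => ?_⟩⟩
      · have hbox := hI.box (by omega)
        refine ⟨by omega, by omega, fun hz => ⟨by omega, ?_, by omega⟩, fun hz => ⟨?_, by omega⟩⟩
        · exact key _ _ _ (Or.inl ⟨hr, rfl, rfl⟩) (Or.inl ⟨hb, by omega⟩)
        · exact key _ _ _ (Or.inl ⟨hr, rfl, rfl⟩) (Or.inl ⟨hb, by omega⟩)
      · exact ⟨key _ _ _ (Or.inl ⟨hr, rfl, rfl⟩) (Or.inr ⟨hb, rfl⟩), by omega⟩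
      · refine ⟨by omega, fun hz => ⟨by omega, ?_, by omega⟩, fun hz => ⟨?_, by omega⟩⟩
        · exact key _ _ _ (Or.inr ⟨hr, rfl, rfl⟩) (Or.inl ⟨by omega, by rw [e1]; omega⟩)
        · exact key _ _ _ (Or.inr ⟨hr, rfl, rfl⟩) (Or.inl ⟨by omega, by rw [e1]; omega⟩)
      · exact ⟨key _ _ _ (Or.inr ⟨hr, rfl, rfl⟩) (Or.inr ⟨by omega, rfl⟩), by omega⟩
  · rintro τ ⟨hI, hv⟩ hF i hi hin
    have e0 : τ.reg 0 = n := by rw [hF.1 0 (by decide), h0]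
    simp [e0] at hv
    exact hI.done i hi (by omega)

/-! ### Periods up to the least break -/

/-- The invariant of `breakGcd`: `h` is the greatest common divisor of the breaks before `b`, the least
of which is `l` (if there are any; `h = 0` otherwise), and `g` is an upper bound for the common divisors
of `h` and `b`, which is less than `h` only if `b` is a break. -/
structure GcdInv (f : ℤ → ℤ) (n b g h l : ℤ) : Prop where
  one_le : 1 ≤ b
  le_n : b ≤ n
  nonneg : 0 ≤ g
  g_le : g ≤ h
  h_le : h ≤ n
  dvd_iff : ∀ d, d ∣ h ↔ ∀ x, 0 < x → x < b → IsBreak f x → d ∣ x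
  zero : h = 0 → ∀ x, 0 < x → x < b → ¬ IsBreak f x
  pos : 0 < h → 0 < g ∧ 0 < l ∧ l < b ∧ IsBreak f l ∧ ∀ x, 0 < x → x < l → ¬ IsBreak f x
  le_g : ∀ d, d ∣ h → d ∣ b → 0 < h → d ≤ g
  eq_or : g = h ∨ IsBreak f b

theorem GcdInv.skip {f : ℤ → ℤ} {n b g h l : ℤ} (H : GcdInv f n b g h l) (hb : b < n)
    (hbr : ¬ IsBreak f b) : GcdInv f n (b + 1) g h l := by
  obtain ⟨h1, h2, h3, h4, h5, h6, h7, h8, h9, h10⟩ := H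
  have hgh := h10.resolve_right hbr
  have hx : ∀ x, x < b + 1 → IsBreak f x → x < b := fun x hx hxb => by
    rcases (Int.lt_add_one_iff.1 hx).eq_or_lt with rfl | h
    · exact absurd hxb hbr
    · exact h
  refine ⟨by omega, by omega, h3, h4, h5, fun d => ?_, fun h0 x hx0 hxb hxbr => ?_, fun h0 => ?_,
    fun d hd _ h0 => by rw [hgh]; exact Int.le_of_dvd h0 hd, Or.inl hgh⟩
  · rw [h6]
    exact ⟨fun H x h0 hxb hxbr => H x h0 (hx x hxb hxbr) hxbr,
      fun H x h0 hxb hxbr => H x h0 (by omega) hxbr⟩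
  · exact h7 h0 x hx0 (hx x hxb hxbr) hxbr
  · obtain ⟨p1, p2, p3, p4, p5⟩ := h8 h0
    exact ⟨p1, p2, by omega, p4, p5⟩

theorem GcdInv.first {f : ℤ → ℤ} {n b g l : ℤ} (H : GcdInv f n b g 0 l) (hb : b < n)
    (hbr : IsBreak f b) : GcdInv f n (b + 1) b b b := by
  obtain ⟨h1, h2, h3, h4, h5, h6, h7, h8, h9, h10⟩ := H
  refine ⟨by omega, by omega, by omega, le_rfl, by omega, fun d => ⟨fun hd x hx0 hxb hxbr => ?_,
    fun H => H b (by omega) (by omega) hbr⟩, by omega,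
    fun _ => ⟨by omega, by omega, by omega, hbr, h7 rfl⟩,
    fun d hd _ h0 => Int.le_of_dvd h0 hd, Or.inl rfl⟩
  rcases (Int.lt_add_one_iff.1 hxb).eq_or_lt with rfl | h
  · exact hd
  · exact absurd hxbr (h7 rfl x hx0 h)

theorem GcdInv.decr {f : ℤ → ℤ} {n b g h l : ℤ} (H : GcdInv f n b g h l) (hh : 0 < h)
    (hbr : IsBreak f b) (hg : ¬ (g ∣ h ∧ g ∣ b)) : GcdInv f n b (g - 1) h l := by
  obtain ⟨h1, h2, h3, h4, h5, h6, h7, h8, h9, h10⟩ := H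
  have hg1 : g ≠ 1 := fun h => hg (by rw [h]; exact ⟨one_dvd _, one_dvd _⟩)
  obtain ⟨p1, p⟩ := h8 hh
  refine ⟨h1, h2, by omega, by omega, h5, h6, h7, fun _ => ⟨by omega, p⟩, fun d hd hdb h0 => ?_,
    Or.inr hbr⟩
  have h11 := h9 d hd hdb h0
  have h12 : d ≠ g := fun h => hg ⟨h ▸ hd, h ▸ hdb⟩
  omega

theorem GcdInv.commit {f : ℤ → ℤ} {n b g h l : ℤ} (H : GcdInv f n b g h l) (hh : 0 < h)
    (hb : b < n) (hbr : IsBreak f b) (hg : g ∣ h) (hg' : g ∣ b) :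
    GcdInv f n (b + 1) g g l := by
  obtain ⟨h1, h2, h3, h4, h5, h6, h7, h8, h9, h10⟩ := H
  obtain ⟨p1, p2, p3, p4, p5⟩ := h8 hh
  have heq : (Int.gcd h b : ℤ) = g := le_antisymm
    (h9 _ (Int.gcd_dvd_left ..) (Int.gcd_dvd_right ..) hh)
    (Int.le_of_dvd (by exact_mod_cast Int.gcd_pos_of_ne_zero_left _ hh.ne')
      (Int.dvd_coe_gcd hg hg'))
  refine ⟨by omega, by omega, h3, le_rfl, by omega, fun d => ⟨fun hd x hx0 hxb hxbr => ?_,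
    fun H => ?_⟩, by omega, fun _ => ⟨p1, p2, by omega, p4, p5⟩,
    fun d hd _ h0 => Int.le_of_dvd h0 hd, Or.inl rfl⟩
  · rcases (Int.lt_add_one_iff.1 hxb).eq_or_lt with rfl | h
    · exact hd.trans hg'
    · exact (h6 d).1 (hd.trans hg) x hx0 h hxbr
  · rw [← heq]
    exact Int.dvd_coe_gcd ((h6 d).2 fun x hx0 hxb hxbr => H x hx0 (by omega) hxbr)
      (H b (by omega) (by omega) hbr)

/-- Register `9` becomes the greatest common divisor of all breaks (`0` if there are none), and
register `10` the least break. The greatest common divisor with a further break is found by decreasing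
the candidate in register `8`, which takes linear time altogether. -/
def breakGcd : Cmd :=
  (4 :=: cst 1 ;; 8 :=: cst 0 ;; 9 :=: cst 0 ;; 10 :=: cst 0) ;;
  .loop ((rg 4).lt (rg 0))
    (.ite (sameCmp (cst 0) (cst 1) (rg 4 - cst 1) (rg 4))
      (4 :=: rg 4 + cst 1)
      (.ite ((rg 9).eq (cst 0))
        (8 :=: rg 4 ;; 9 :=: rg 4 ;; 10 :=: rg 4 ;; 4 :=: rg 4 + cst 1)
        (.ite (rg 9 % rg 8 + rg 4 % rg 8)
          (8 :=: rg 8 - cst 1)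
          (9 :=: rg 8 ;; 4 :=: rg 4 + cst 1))))

theorem within_breakGcd {B : ℕ} {σ : State} {n : ℤ} {f : ℤ → ℤ} (hn : 1 ≤ n)
    (hB : 2 * n + 4 ≤ B) (h0 : σ.reg 0 = n) (hf : σ.arr 0 = f) :
    Within B breakGcd σ (150 * (2 * n.toNat + 2)) fun τ => ∃ b g,
      b = n ∧ GcdInv f n b g (τ.reg 9) (τ.reg 10) := by
  have hB1 : 1 ≤ B := by omega
  refine (Within.seq_loop 150
    (I := fun τ => GcdInv f n (τ.reg 4) (τ.reg 8) (τ.reg 9) (τ.reg 10))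
    -- The candidate only decreases; before the first break, `n` bounds its future value.
    (φ := fun τ => (n - τ.reg 4).toNat + if τ.reg 9 = 0 then n.toNat else (τ.reg 8).toNat)
    (N := 2 * n.toNat) (by decide) (by decide)
    ?_ fun τ hI hF => ?_).mono le_rfl ?_
  · simp [Cmd.wp, hB1]
    refine ⟨⟨le_rfl, hn, le_rfl, le_rfl, by omega, fun d => ?_, fun _ x h0 h1 => by omega,
      by omega, fun d _ _ h => by omega, Or.inl rfl⟩, by omega⟩
    simp only [dvd_zero, true_iff]
    intro x h0 h1
    omega
  · have e0 : τ.reg 0 = n := by rw [hF.1 0 (by decide), h0]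
    have ef : τ.arr 0 = f := by rw [hF.2 0 (by decide), hf]
    refine ⟨by simp [hB1], fun hlt => ?_⟩
    simp [e0] at hlt
    have i1 := hI.one_le
    have i2 := hI.nonneg
    have i3 := hI.g_le
    have i4 := hI.h_le
    have hOk : (sameCmp (cst 0) (cst 1) (rg 4 - cst 1) (rg 4)).Ok B τ :=
      ok_sameCmp hB1 (by simp) (by simpa using hB1)
        (by simp [hB1, abs_le]; omega) (by simp)
    simp only [Cmd.wp, hOk, true_and, val_sameCmp]
    simp [hB1, ef, abs_le]
    refine ⟨fun hs => ?_, fun hbr => ⟨fun h9 => ?_, fun h9 => ?_⟩⟩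
    · exact ⟨by omega, hI.skip hlt (not_not.2 hs), hlt⟩
    · replace h9 : τ.reg 9 = 0 := by
        by_contra h
        simp [h] at h9
      rw [h9] at hI
      refine ⟨by omega, hI.first hlt hbr, ?_⟩
      rw [if_neg (by omega), if_pos h9]
      omega
    · replace h9 : τ.reg 9 ≠ 0 := fun h => by simp [h] at h9
      have hh : 0 < τ.reg 9 := by omega
      have hg := (hI.pos hh).1
      have m1 := Int.emod_nonneg (τ.reg 9) hg.ne'
      have m2 := Int.emod_nonneg (τ.reg 4) hg.ne'
      have m3 := Int.emod_lt_of_pos (τ.reg 9) hg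
      have m4 := Int.emod_lt_of_pos (τ.reg 4) hg
      refine ⟨⟨Expr.ok_mod (by simp) (by simp) (by simp; omega) (by simp; omega) (by simp; omega),
        Expr.ok_mod (by simp) (by simp) (by simp; omega) (by simp; omega) (by simp; omega),
        by omega⟩, fun hm => ⟨by omega, hI.decr hh hbr ?_, ?_⟩,
        fun hm => ⟨by omega, hI.commit hh hlt hbr ?_ ?_, ?_⟩⟩
      · rintro ⟨d1, d2⟩
        rw [Int.emod_eq_zero_of_dvd d1, Int.emod_eq_zero_of_dvd d2] at hm
        exact hm rfl
      · rw [if_neg h9, if_neg h9]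
        omega
      · exact Int.dvd_of_emod_eq_zero (by omega)
      · exact Int.dvd_of_emod_eq_zero (by omega)
      · rw [if_neg (by omega), if_neg h9]
        omega
  · rintro τ ⟨hI, hv⟩ hF
    have e0 : τ.reg 0 = n := by rw [hF.1 0 (by decide), h0]
    simp [e0] at hv
    exact ⟨_, _, le_antisymm hI.le_n hv, hI⟩

/-- `v` is the smallest initial op-period greater than `1`, or `0` if there is none. -/
def IsAnswer (f : ℤ → ℤ) (n v : ℤ) : Prop :=
  (1 < v ∧ v < n ∧ Per f v n ∧ ∀ d, 1 < d → d < v → ¬ Per f d n) ∨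
    (v = 0 ∧ ∀ d, 1 < d → d < n → ¬ Per f d n)

/-- The initial op-periods that do not exceed the least break are the common divisors of the breaks. -/
theorem GcdInv.per_iff {f : ℤ → ℤ} {n g h l p : ℤ} (H : GcdInv f n n g h l) (hp : 0 < p)
    (hpl : 0 < h → p ≤ l) : Per f p n ↔ p ∣ h := by
  rw [H.dvd_iff]
  refine ⟨fun hper x hx hxn hxb => hper.dvd_of_isBreak hp (fun y hy hyp => ?_) hx hxn hxb,
    fun hd => Per.of_dvd_breaks hp hd⟩
  rcases (H.nonneg.trans H.g_le).eq_or_lt with h0 | h0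
  · exact absurd hxb (H.zero h0.symm x hx hxn)
  · exact (H.pos h0).2.2.2.2 y hy (by have := hpl h0; omega)

/-- Register `4` becomes the smallest divisor greater than `1` of register `9` (`2` if that is `0`). -/
def minDivisor : Cmd :=
  4 :=: cst 2 ;; .loop (rg 9 % rg 4) (4 :=: rg 4 + cst 1)

theorem within_minDivisor {B : ℕ} {σ : State} {n g h l : ℤ} {f : ℤ → ℤ} (hn : 3 ≤ n)
    (hB : 2 * n + 4 ≤ B) (h9 : σ.reg 9 = h) (H : GcdInv f n n g h l) (h1 : h ≠ 1) :
    Within B minDivisor σ (30 * (n.toNat + 2)) fun τ => IsAnswer f n (τ.reg 4) := by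
  have hh0 := H.nonneg.trans H.g_le
  have hhn := H.h_le
  refine (Within.seq_loop 30
    (I := fun τ => 2 ≤ τ.reg 4 ∧ (τ.reg 4 ≤ 2 ∨ τ.reg 4 ≤ h) ∧
      ∀ d, 1 < d → d < τ.reg 4 → ¬ d ∣ h)
    (φ := fun τ => (h - τ.reg 4).toNat)
    (N := n.toNat) (by decide) (by decide)
    ?_ fun τ hI hF => ?_).mono le_rfl ?_
  · simp [Cmd.wp]
    exact ⟨by omega, by intros; omega, by omega⟩
  · have e9 : τ.reg 9 = h := by rw [hF.1 9 (by decide), h9]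
    obtain ⟨i1, i2, i3⟩ := hI
    refine ⟨Expr.ok_mod (by simp) (by simp) (by simp; omega) (by simp; omega) (by simp; omega),
      fun hv => ?_⟩
    simp [e9] at hv
    have hne : τ.reg 4 ≠ h := fun h' => hv (by rw [h'])
    have hh : h ≠ 0 := fun h' => hv (by rw [h']; exact dvd_zero _)
    simp [Cmd.wp, abs_le]
    refine ⟨by omega, ⟨by omega, by omega, fun d hd hd' => ?_⟩, by omega⟩
    rcases hd'.eq_or_lt with rfl | hlt
    · exact hv
    · exact i3 d hd hlt
  · rintro τ ⟨⟨i1, i2, i3⟩, hv⟩ hF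
    have e9 : τ.reg 9 = h := by rw [hF.1 9 (by decide), h9]
    simp [e9] at hv
    have hl : 0 < h → h ≤ l ∧ l < n := fun h0 => by
      obtain ⟨p1, p2, p3, p4, p5⟩ := H.pos h0
      exact ⟨Int.le_of_dvd p2 ((H.dvd_iff h).1 dvd_rfl l p2 p3 p4), p3⟩
    have hpl : 0 < h → τ.reg 4 ≤ l := fun h0 => by
      have := Int.le_of_dvd h0 hv
      have := hl h0
      omega
    refine Or.inl ⟨by omega, ?_, (H.per_iff (by omega) hpl).2 hv, fun d hd hd' => ?_⟩
    · rcases hh0.eq_or_lt with h0 | h0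
      · omega
      · have := hl h0
        have := hpl h0
        omega
    · rw [H.per_iff (by omega) fun h0 => by have := hpl h0; omega]
      exact i3 d hd hd'

/-! ### Periods greater than the least break -/

theorem ediv_emod_of_block {p k i : ℤ} (hp : 0 < p) (h : p * k ≤ i) (h' : i < p * k + p) :
    i / p = k ∧ i % p = i - p * k := by
  have e : i = (i - p * k) + p * k := by ring
  constructor
  · rw [e, Int.add_mul_ediv_left _ _ hp.ne', Int.ediv_eq_zero_of_lt (by omega) (by omega), zero_add]
  · conv_lhs => rw [e, Int.add_mul_emod_self_left]
    exact Int.emod_eq_of_lt (by omega) (by omega)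

/-- A match of length `p`, or up to the end of the string, verifies one more block. -/
theorem Per.extend {f : ℤ → ℤ} {n p k v : ℤ} (hp : 0 < p) (h : Per f p (min (p * k) n))
    (hm : Match f (p * k) v) (hv : p ≤ v ∨ n ≤ p * k + v) : Per f p (min (p * k + p) n) := by
  intro i j hi him hj hjm hij
  have hlow : ∀ x, x < p * k ↔ x / p < k := fun x => by
    rw [Int.ediv_lt_iff_lt_mul hp, mul_comm]
  by_cases hik : i < p * k
  · have hjk : j < p * k := by rw [hlow] at hik ⊢; omega
    exact h i j hi (by omega) hj (by omega) hij
  · have hjk : ¬ j < p * k := by rw [hlow] at hik ⊢; omega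
    rw [(ediv_emod_of_block hp (not_lt.1 hik) (by omega)).2,
      (ediv_emod_of_block hp (not_lt.1 hjk) (by omega)).2,
      hm (i - p * k) (j - p * k) (by omega) (by omega) (by omega) (by omega)]
    simp

/-- Each block of a period matches the prefix. -/
theorem Per.match {f : ℤ → ℤ} {n p k v : ℤ} (hp : 0 < p) (hk : 0 ≤ p * k) (h : Per f p n)
    (hv : v ≤ p) (hvn : p * k + v ≤ n) : Match f (p * k) v := by
  intro x y hx hxv hy hyv
  obtain ⟨a1, a2⟩ := ediv_emod_of_block (p := p) (k := k) (i := p * k + x) hp (by omega) (by omega)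
  obtain ⟨b1, b2⟩ := ediv_emod_of_block (p := p) (k := k) (i := p * k + y) hp (by omega) (by omega)
  rw [h (p * k + x) (p * k + y) (by omega) (by omega) (by omega) (by omega) (by rw [a1, b1]), a2, b2]
  simp

/-- The invariant of `search`: all candidates less than `p` are excluded, and `p` is an initial
op-period of the prefix of length `m`, a multiple of `p`. -/
structure SearchInv (f : ℤ → ℤ) (n l p m : ℤ) : Prop where
  lt : l < p
  le_n : p ≤ n
  dvd : ∃ k, 1 ≤ k ∧ m = p * k
  lt_add : m < n + p
  per : Per f p (min m n)
  not_per : ∀ d, 1 < d → d < p → ¬ Per f d n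

theorem SearchInv.start {f : ℤ → ℤ} {n l p : ℤ} (hl : 0 < l) (hlp : l < p) (hpn : p ≤ n)
    (h : ∀ d, 1 < d → d < p → ¬ Per f d n) : SearchInv f n l p p := by
  refine ⟨hlp, hpn, ⟨1, le_rfl, by ring⟩, by omega, fun i j hi him hj hjm _ => ?_, h⟩
  rw [Int.emod_eq_of_lt hi (by omega), Int.emod_eq_of_lt hj (by omega)]

theorem SearchInv.extend {f : ℤ → ℤ} {n l p m v : ℤ} (hl : 0 < l) (H : SearchInv f n l p m)
    (hm : m < n) (hz : IsZ f n m v) (hv : p ≤ v ∨ n ≤ m + v) : SearchInv f n l p (m + p) := by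
  obtain ⟨h1, h2, ⟨k, hk, rfl⟩, h4, h5, h6⟩ := H
  exact ⟨h1, h2, ⟨k + 1, by omega, by ring⟩, by omega, h5.extend (by omega) hz.2.2.1 hv, h6⟩

/-- After a mismatch in the block at `m`, the next candidate is `m - p + 1`, or `p + 1` if this is
greater. -/
theorem SearchInv.restart {f : ℤ → ℤ} {n l p m v p' : ℤ} (hl : 0 < l) (hlb : IsBreak f l)
    (H : SearchInv f n l p m) (hm : m < n) (hpn : p < n) (hz : IsZ f n m v) (hvp : v < p)
    (hvn : m + v < n) (hp' : p' = max (p + 1) (m - p + 1)) : SearchInv f n l p' p' := by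
  obtain ⟨h1, h2, ⟨k, hk, rfl⟩, h4, h5, h6⟩ := H
  have hno : ∀ d, 1 < d → d ≤ p → ¬ Per f d n := fun d hd hdp => by
    rcases hdp.eq_or_lt with rfl | hlt
    · exact fun h => hz.2.2.2 hvn (h.match (by omega) (by nlinarith) (by omega) (by omega))
    · exact h6 d hd hlt
  refine SearchInv.start hl (by omega) (by omega) fun d hd hd' => ?_
  by_cases hdp : d ≤ p
  · exact hno d hd hdp
  · exact not_per_of_per_prefix hl h1 hlb (not_le.1 hdp) (by omega) hm.le
      (by rwa [min_eq_left hm.le] at h5) hno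

/-- Register `8` becomes the smallest initial op-period greater than the break in register `10`, or the
length of the string if there is none; no number in `(1, l]` may be an initial op-period, where `l` is
that break. Register `6` counts the letters for which the candidate in
register `8` has been verified. -/
def search : Cmd :=
  (8 :=: rg 10 + cst 1 ;; 6 :=: rg 8) ;;
  .loop ((rg 8).lt (rg 0) * (rg 6).lt (rg 0))
    (.ite ((rd 6 (rg 6)).lt (rg 8) * (rd 6 (rg 6) + rg 6).lt (rg 0))
      (6 :=: rg 6 - rg 8 + cst 1 ;;
        .ite ((rg 8).lt (rg 6)) (8 :=: rg 6) (8 :=: rg 8 + cst 1 ;; 6 :=: rg 8))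
      (6 :=: rg 6 + rg 8))

theorem within_search {B : ℕ} {σ : State} {n l : ℤ} {f : ℤ → ℤ} (hn : 3 ≤ n)
    (hB : 2 * n + 4 ≤ B) (h0 : σ.reg 0 = n) (h10 : σ.reg 10 = l)
    (hz : ∀ i, 1 ≤ i → i < n → IsZ f n i (σ.arr 6 i)) (hl : 0 < l) (hln : l < n)
    (hlb : IsBreak f l) (hno : ∀ d, 1 < d → d ≤ l → ¬ Per f d n) :
    Within B search σ (100 * (3 * n.toNat + 2 + 2)) fun τ =>
      (τ.reg 8 < n ∧ IsAnswer f n (τ.reg 8)) ∨ (¬ τ.reg 8 < n ∧ IsAnswer f n 0) := by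
  have hB1 : 1 ≤ B := by omega
  refine (Within.seq_loop 100
    (I := fun τ => SearchInv f n l (τ.reg 8) (τ.reg 6))
    -- After `k` blocks, the candidate increases by at least `(k - 2) * p + 1`, which pays for the blocks
    -- already tested.
    (φ := fun τ => (2 * (n - τ.reg 8) + (n + 2) - τ.reg 6 / τ.reg 8).toNat)
    (N := 3 * n.toNat + 2) (by decide) (by decide)
    ?_ fun τ hI hF => ?_).mono le_rfl ?_
  · have : (l + 1) / (l + 1) = 1 := Int.ediv_self (by omega)
    simp [Cmd.wp, h10, abs_le, this]
    exact ⟨by omega, .start hl (by omega) (by omega) fun d h1 h2 => hno d h1 (by omega), by omega⟩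
  · have e0 : τ.reg 0 = n := by rw [hF.1 0 (by decide), h0]
    have e6 : τ.arr 6 = σ.arr 6 := hF.2 6 (by decide)
    have i1 := hI.lt
    have i2 := hI.le_n
    have i3 := hI.lt_add
    obtain ⟨k, hk, hmk⟩ := hI.dvd
    have hm0 : τ.reg 8 ≤ τ.reg 6 := by rw [hmk]; nlinarith
    have hdiv : τ.reg 6 / τ.reg 8 = k := by rw [hmk, Int.mul_ediv_cancel_left _ (by omega)]
    have hOk : ∀ e f : Prop, ∀ [Decidable e] [Decidable f],
        |if e then (1 : ℤ) else 0| * |if f then (1 : ℤ) else 0| ≤ B := by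
      intro e f _ _
      split_ifs <;> simp
      all_goals omega
    refine ⟨by simpa [hB1] using hOk _ _, fun hlt => ?_⟩
    simp [e0] at hlt
    obtain ⟨hm, hp⟩ := hlt
    have hzm := hz (τ.reg 6) (by omega) hm
    have z1 := hzm.1
    have z2 := hzm.2.1
    simp [Cmd.wp, hB1, e6, e0, abs_le]
    have hkn : k < n := by nlinarith
    have hk2 : 2 * τ.reg 8 ≤ τ.reg 6 → 2 * k + 2 * τ.reg 8 - 4 ≤ τ.reg 6 := fun h => by
      have : 2 ≤ k := by nlinarith
      nlinarith
    have hk1 : τ.reg 6 < 2 * τ.reg 8 → k = 1 := fun h => by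
      have : k < 2 := by nlinarith
      omega
    have hdiv' : (τ.reg 6 + τ.reg 8) / τ.reg 8 = k + 1 := by
      rw [Int.add_ediv_of_dvd_right dvd_rfl, hdiv, Int.ediv_self (by omega)]
    refine ⟨⟨by omega, by split_ifs <;> omega, by split_ifs <;> omega⟩,
      fun hvn hvp => ⟨by omega, fun hlt' => ?_, fun hlt' => ?_⟩, fun hge => ?_⟩
    · rw [Int.ediv_self (by omega), hdiv]
      refine ⟨hI.restart hl hlb hm hp hzm hvp (by omega) (by omega), ?_, ?_⟩
      · have := hk2 (by omega)
        omega
      · omega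
    · rw [Int.ediv_self (by omega), hdiv]
      refine ⟨by omega, hI.restart hl hlb hm hp hzm hvp (by omega) (by omega), ?_, ?_⟩
      · have := hk1 (by omega)
        omega
      · omega
    · rw [hdiv, hdiv']
      exact ⟨by omega, hI.extend hl hm hzm (by omega), by omega, by omega⟩
  · rintro τ ⟨hI, hv⟩ hF
    have e0 : τ.reg 0 = n := by rw [hF.1 0 (by decide), h0]
    simp [e0] at hv
    by_cases hp : τ.reg 8 < n
    · have := hI.lt
      have hv' : n ≤ τ.reg 6 := by grind
      refine Or.inl ⟨hp, Or.inl ⟨by omega, hp, ?_, hI.not_per⟩⟩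
      have := hI.per
      rwa [min_eq_right hv'] at this
    · exact Or.inr ⟨hp, Or.inr ⟨rfl, fun d h1 h2 => hI.not_per d h1 (by omega)⟩⟩

/-! ### The program -/

/-- Register `0` becomes the answer, from the results of `prefixArray` and `breakGcd`. -/
def report : Cmd :=
  .ite ((rg 9).eq (cst 1))
    (search ;; .ite ((rg 8).lt (rg 0)) (0 :=: rg 8) (0 :=: cst 0))
    (minDivisor ;; 0 :=: rg 4)

theorem within_report {B : ℕ} {σ : State} {n g h l : ℤ} {f : ℤ → ℤ} (hn : 3 ≤ n)
    (hB : 2 * n + 4 ≤ B) (h0 : σ.reg 0 = n) (h9 : σ.reg 9 = h) (h10 : σ.reg 10 = l)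
    (hz : ∀ i, 1 ≤ i → i < n → IsZ f n i (σ.arr 6 i)) (H : GcdInv f n n g h l) :
    Within B report σ (300 * n.toNat + 500) fun τ => IsAnswer f n (τ.reg 0) := by
  have hB1 : 1 ≤ B := by omega
  refine (Within.ite (T := 300 * n.toNat + 490) (by simp [hB1]) (fun hv => ?_) fun hv => ?_).mono
    (by simp only [Expr.cost, Expr.eq]; omega) fun _ hq _ => hq
  · have h1 : h = 1 := by
      by_contra h
      simp [h9, h] at hv
    obtain ⟨-, p2, p3, p4, -⟩ := H.pos (by omega)
    refine ((within_search hn hB h0 h10 hz p2 p3 p4 fun d h2 h3 hper => ?_).seq (T' := 30)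
      (Q := fun τ => IsAnswer f n (τ.reg 0)) fun τ hτ hF => ?_).mono
      (by omega) fun _ hq _ => hq
    · rw [H.per_iff (by omega) fun _ => h3, h1] at hper
      exact absurd (Int.le_of_dvd one_pos hper) (by omega)
    · have e0 : τ.reg 0 = n := by rw [hF.1 0 (by decide), h0]
      refine (Within.of_wp ?_).mono (by decide) fun _ hq _ => hq
      simp [Cmd.wp, hB1, e0]
      exact ⟨fun hlt => by grind, fun hge => by grind⟩
  · have h1 : h ≠ 1 := fun h1 => by simp [h9, h1] at hv
    refine ((within_minDivisor hn hB h9 H h1).seq (T' := 30)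
      (Q := fun τ => IsAnswer f n (τ.reg 0)) fun τ hτ _ => ?_).mono
      (by omega) fun _ hq _ => hq
    exact (Within.of_wp (by simpa [Cmd.wp] using hτ)).mono (by decide) fun _ hq _ => hq

/-- The smallest initial op-period greater than `1` is written to register `0`. Strings of length less
than `3` have none; for all others the positions `0` and `1` used by the test for breaks exist. -/
def smallestPeriod : Cmd :=
  .ite ((rg 0).lt (cst 3)) (0 :=: cst 0)
    (sortPositions ;; link ;; unlink ;; prefixArray ;; breakGcd ;; report)

theorem within_smallestPeriod {B c n : ℕ} {σ : State} {f : ℤ → ℤ}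
    (hB : 2 * ((n : ℤ) + 2) ^ (c + 1) + n + 3 ≤ B) (h0 : σ.reg 0 = n) (hf : σ.arr 0 = f)
    (hc : ∀ i, 0 ≤ i → i < (n : ℤ) → |f i| ≤ ((n : ℤ) + 2) ^ c) :
    Within B smallestPeriod σ ((c + 4) * (400 * (n + 2)) + (1100 * n + 2000)) fun τ =>
      IsAnswer f n (τ.reg 0) := by
  have hpow : (n : ℤ) + 2 ≤ ((n : ℤ) + 2) ^ (c + 1) := le_self_pow₀ (by omega) (by omega)
  have hB1 : 1 ≤ B := by omega
  refine (Within.ite (T := (c + 4) * (400 * (n + 2)) + (1100 * n + 1990)) (by simp [hB1]; omega)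
    (fun hv => ?_) fun hv => ?_).mono (by simp only [Expr.cost, Expr.lt]; omega) fun _ hq _ => hq
  · simp [h0] at hv
    refine (Within.of_wp (Q := fun τ => IsAnswer f n (τ.reg 0)) ?_).mono
      ((by decide : _ ≤ 1990).trans (by omega)) fun _ hq _ => hq
    simp [Cmd.wp]
    exact Or.inr ⟨rfl, by intros; omega⟩
  · simp [h0] at hv
    have hn : (3 : ℤ) ≤ n := by omega
    refine ((within_sortPositions hB h0 hf hc).seq (T' := 1100 * n + 1990)
      (Q := fun τ => IsAnswer f n (τ.reg 0)) fun τ₁ h1 F1 => ?_).mono le_rfl fun _ hq _ => hq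
    obtain ⟨l, he, hl, hs⟩ := h1
    have e1 : τ₁.reg 0 = n := by rw [F1.1 0 (by decide), h0]
    have f1 : τ₁.arr 0 = f := by rw [F1.2 0 (by decide), hf]
    refine ((within_link (by omega) (by omega) e1 he hl hs).seq (T' := 1050 * n + 1890)
      (Q := fun τ => IsAnswer f n (τ.reg 0)) fun τ₂ h2 F2 => ?_).mono (by omega) fun _ hq _ => hq
    have e2 : τ₂.reg 0 = n := by rw [F2.1 0 (by decide), e1]
    have f2 : τ₂.arr 0 = f := by rw [F2.2 0 (by decide), f1]
    refine ((within_unlink (by omega) (by omega) e2 h2).seq (T' := 1000 * n + 1790)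
      (Q := fun τ => IsAnswer f n (τ.reg 0)) fun τ₃ h3 F3 => ?_).mono (by omega) fun _ hq _ => hq
    have e3 : τ₃.reg 0 = n := by rw [F3.1 0 (by decide), e2]
    have f3 : τ₃.arr 0 = f := by rw [F3.2 0 (by decide), f2]
    refine ((within_prefixArray (by omega) (by omega) e3 f3 h3).seq (T' := 600 * n + 1390)
      (Q := fun τ => IsAnswer f n (τ.reg 0)) fun τ₄ h4 F4 => ?_).mono (by omega) fun _ hq _ => hq
    have e4 : τ₄.reg 0 = n := by rw [F4.1 0 (by decide), e3]
    have f4 : τ₄.arr 0 = f := by rw [F4.2 0 (by decide), f3]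
    refine ((within_breakGcd (by omega) (by omega) e4 f4).seq (T' := 300 * n + 500)
      (Q := fun τ => IsAnswer f n (τ.reg 0)) fun τ₅ h5 F5 => ?_).mono (by omega) fun _ hq _ => hq
    obtain ⟨b, g, rfl, H⟩ := h5
    have e5 : τ₅.reg 0 = n := by rw [F5.1 0 (by decide), e4]
    have a5 : τ₅.arr 6 = τ₄.arr 6 := F5.2 6 (by decide)
    exact within_report hn (by omega) e5 rfl rfl (by rwa [a5]) H

/-- Translation of the answer to natural numbers. -/
theorem IsAnswer.exists_nat {S : List ℤ} {v : ℤ} (h : IsAnswer (letters S) S.length v) :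
    ∃ p : ℕ, v = p ∧ (IsLeast {q : ℕ | 1 < q ∧ IsInitialOpPeriod S q} p ∨
      ({q : ℕ | 1 < q ∧ IsInitialOpPeriod S q} = ∅ ∧ p = 0)) := by
  rcases h with ⟨h1, h2, h3, h4⟩ | ⟨rfl, h⟩
  · lift v to ℕ using by omega
    refine ⟨v, rfl, Or.inl ⟨⟨by omega, isInitialOpPeriod_iff.2 ⟨by omega, by omega, h3⟩⟩, ?_⟩⟩
    rintro q ⟨hq, hper⟩
    by_contra hlt
    exact h4 q (by omega) (by omega) (isInitialOpPeriod_iff.1 hper).2.2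
  · refine ⟨0, rfl, Or.inr ⟨Set.eq_empty_iff_forall_notMem.2 ?_, rfl⟩⟩
    rintro q ⟨hq, hper⟩
    obtain ⟨-, h2, h3⟩ := isInitialOpPeriod_iff.1 hper
    exact h q (by omega) (by omega) h3

end OP

/-- One program computes, in time linear in the length of the string, the smallest initial op-period
greater than `1` of every string over a polynomially bounded integer alphabet (and answers `0` if
the string has no such op-period). Words have `O(log n)` bits. -/
theorem mainTheorem4 :
    ∃ P : OP.Cmd, ∀ c : ℕ, ∃ C : ℕ, ∀ S : List ℤ,
      (∀ x ∈ S, |x| ≤ ((S.length : ℤ) + 2) ^ c) →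
      ∃ (t : ℕ) (τ : OP.State) (p : ℕ),
        OP.Exec ((S.length + 2) ^ C) P (OP.inputState S) t τ ∧
        t ≤ C * (S.length + 1) ∧
        τ.reg 0 = (p : ℤ) ∧
        (IsLeast {q : ℕ | 1 < q ∧ OP.IsInitialOpPeriod S q} p ∨
          ({q : ℕ | 1 < q ∧ OP.IsInitialOpPeriod S q} = ∅ ∧ p = 0)) := by
  refine ⟨OP.smallestPeriod, fun c => ?_⟩
  -- This is large enough both for the time bound and for words up to
  -- `2 * (n + 2) ^ (c + 1) + n + 3`.
  obtain ⟨C, hC⟩ : ∃ C, C = 2000 * (c + 5) := ⟨_, rfl⟩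
  refine ⟨C, fun S hS => ?_⟩
  have hB : 2 * ((S.length : ℤ) + 2) ^ (c + 1) + S.length + 3 ≤
      ((S.length + 2) ^ C : ℕ) := by
    have h1 : (S.length + 2) ^ (c + 1 + 3) ≤ (S.length + 2) ^ C :=
      Nat.pow_le_pow_right (by omega) (by omega)
    have h2 : S.length + 2 ≤ (S.length + 2) ^ (c + 1) := Nat.le_self_pow (by omega) _
    have h3 : 2 ^ 3 ≤ (S.length + 2) ^ 3 := Nat.pow_le_pow_left (by omega) _
    rw [pow_add] at h1
    have h4 := Nat.mul_le_mul_left ((S.length + 2) ^ (c + 1)) h3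
    have h5 : 2 * (S.length + 2) ^ (c + 1) + S.length + 3 ≤
      (S.length + 2) ^ C := by omega
    exact_mod_cast h5
  have hletters : (OP.inputState S).arr 0 = OP.letters S := by
    funext i
    simp [OP.inputState, OP.letters]
  obtain ⟨t, τ, hx, ht, hans⟩ := OP.within_smallestPeriod (σ := OP.inputState S) (c := c) hB
    (by simp [OP.inputState]) hletters fun i h0 hi => by
      lift i to ℕ using h0
      rw [OP.letters_natCast S (by omega)]
      exact hS _ (List.getElem_mem _)
  obtain ⟨p, hp, h⟩ := hans.exists_nat
  exact ⟨t, τ, p, hx, ht.trans (by nlinarith), hp, h⟩
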